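/- All graphs are finite, undirected and without loops or multiple edges. Let $2P_1+P_3$ denote the disjoint union of two isolated vertices and a path on three vertices, and let $\overline{2P_1+P_3}$ denote its complement. The clique-width $\mathrm{cw}(G)$ of a graph $G$ is the minimum number of labels needed to construct $G$ by using the following four operations: (1) creating a new graph consisting of a single vertex with label $i$; (2) taking the disjoint union of two labelled graphs; (3) joining each vertex with label $i$ to each vertex with label $j$, where $i\neq j$; (4) renaming label $i$ to $j$. (The graph with no vertices has clique-width $0$.) **Theorem.** The class of $(2P_1+P_3,\overline{2P_1+P_3})$-free graphs has bounded clique-width. That is, there is a constant $c$ such that every graph $G$ that has no induced subgraph isomorphic to $2P_1+P_3$ or to $\overline{2P_1+P_3}$ satisfies $\mathrm{cw}(G)\leq c$. -/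

import Mathlib

universe u

open SimpleGraph

/-- Clique-width expressions with label set `Fin k`, one constructor for each of the four operations:
creating a single vertex with label `i`; disjoint union of two labelled graphs; joining every vertex
labelled `i` to every vertex labelled `j`, where `i ≠ j`; renaming label `i` to `j`. -/
inductive CWExpr (k : ℕ) : Type
  | single (i : Fin k) : CWExpr k
  | union (s t : CWExpr k) : CWExpr k
  | join (i j : Fin k) (hij : i ≠ j) (t : CWExpr k) : CWExpr k
  | rename (i j : Fin k) (t : CWExpr k) : CWExpr k

namespace CWExpr

/-- The vertex set of the labelled graph built by an expression. -/
def Vert {k : ℕ} : CWExpr k → Type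
  | single _ => Unit
  | union s t => s.Vert ⊕ t.Vert
  | join _ _ _ t => t.Vert
  | rename _ _ t => t.Vert

/-- The vertex labelling of the labelled graph built by an expression. -/
def label {k : ℕ} : (t : CWExpr k) → t.Vert → Fin k
  | single i => fun _ => i
  | union s t => Sum.elim s.label t.label
  | join _ _ _ t => t.label
  | rename i j t => fun v => if t.label v = i then j else t.label v

/-- The underlying graph of the labelled graph built by an expression. -/
def graph {k : ℕ} : (t : CWExpr k) → SimpleGraph t.Vert
  | single _ => ⊥
  | union s t => s.graph ⊕g t.graph
  | join i j _ t => t.graph ⊔ SimpleGraph.fromRel (fun u v => t.label u = i ∧ t.label v = j)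
  | rename _ _ t => t.graph

end CWExpr

/-- `G` can be constructed with at most `k` labels. The graph without vertices needs no operation,
hence no label. -/
def CWConstructible {V : Type u} (k : ℕ) (G : SimpleGraph V) : Prop :=
  IsEmpty V ∨ ∃ t : CWExpr k, Nonempty (t.graph ≃g G)

/-- The clique-width of `G`: the least number of labels with which `G` can be constructed
(`⊤` if there is none, which does not happen for finite graphs). -/
noncomputable def cliqueWidth {V : Type u} (G : SimpleGraph V) : ℕ∞ :=
  ⨅ (k : ℕ) (_ : CWConstructible k G), (k : ℕ∞)

/-- The graph `2P₁ + P₃`: the disjoint union of two single vertices and a path on three vertices. -/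
def twoP1AddP3 : SimpleGraph ((Fin 1 ⊕ Fin 1) ⊕ Fin 3) :=
  (pathGraph 1 ⊕g pathGraph 1) ⊕g pathGraph 3

/-! Suppose the vertices can be added one at a time so that, at every moment, those present have
boundedly many, say `k`, different neighbourhoods among those still missing. Then `k + 1` labels
build `G`, the extra label serving the newest vertex (`Reach.cliqueWidth_le`). The same order works
for the complement with the same `k`, so all arguments may be made up to complementation.

A vertex with two neighbours and two non-neighbours in an independent set yields a `2P₁ + P₃`. Hence
every vertex is sparse (at most one neighbour) or dense (at most one non-neighbour) towards an
independent set and, by complementation, a vertex outside a clique is sparse or dense towards it.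

If `G` contains an induced `5P₁ + 3P₂`, the vertices sparse towards its five isolated vertices
induce a disjoint union of cliques, while the dense ones are independent and each is complete to all
but at most one of these cliques. Such a graph is built clique by clique (`CliquesAndIndep.reach`,
`reach_of_hasU`).

If neither `G` nor its complement contains `5P₁ + 3P₂`, Ramsey's theorem and the dichotomy cover `G`
by boundedly many cliques and independent sets (`Tame.coverable`). Between two large ones the
adjacency is uniform up to a few vertices and a matching (`exists_pairOK`), and a vertex has at most
two such deviations (`Layered.card_devs_le`). The deviations form paths and cycles; adding vertices
along them leaves at most two deviations crossing at any time (`Layered.reach`). -/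

namespace CliqueWidthBound

/-! ### Chains of cuts and clique-width -/

open Classical in
/-- A set `P` of vertices whose elements have at most `k` different neighbourhoods outside `P`. -/
def Cut {V : Type u} (k : ℕ) (G : SimpleGraph V) (P : Finset V) : Prop :=
  ∃ c : V → Fin k, ∀ x ∈ P, ∀ y ∈ P, c x = c y → ∀ w ∉ P, (G.Adj x w ↔ G.Adj y w)

open Classical in
/-- `P` is the end of a chain of sets, growing by one vertex at a time, that all satisfy `Cut k G`. -/
inductive Reach {V : Type u} (k : ℕ) (G : SimpleGraph V) : Finset V → Prop
  | empty : Reach k G ∅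
  | insert (v : V) (P : Finset V) (hv : v ∉ P) (h : Reach k G P) (hc : Cut k G (insert v P)) :
      Reach k G (insert v P)

section Basic

open Classical

variable {V : Type u} {k : ℕ} {G : SimpleGraph V}

/-- Each exceptional vertex in `E` gets a private tag and all others share one more, whence the
factor `E.card + 1`. -/
theorem Cut.of_colouring {ι : Type*} [Fintype ι] {P E : Finset V} (c : V → ι)
    (hk : (E.card + 1) * Fintype.card ι ≤ k)
    (h : ∀ x ∈ P, ∀ y ∈ P, x ∉ E → y ∉ E → c x = c y → ∀ w ∉ P, (G.Adj x w ↔ G.Adj y w)) :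
    Cut k G P := by
  let f : V → Option E × ι := fun v => (if hv : v ∈ E then some ⟨v, hv⟩ else none, c v)
  have hcard : Fintype.card (Option E × ι) ≤ Fintype.card (Fin k) := by
    simpa using hk
  obtain ⟨g⟩ := Function.Embedding.nonempty_of_card_le hcard
  refine ⟨fun v => g (f v), fun x hx y hy hxy w hw => ?_⟩
  have hf : f x = f y := g.injective hxy
  simp only [f, Prod.mk.injEq] at hf
  obtain ⟨h1, h2⟩ := hf
  by_cases hxE : x ∈ E <;> by_cases hyE : y ∈ E <;> simp [hxE, hyE] at h1
  · rw [h1]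
  · exact h x hx y hy hxE hyE h2 w hw

/-- Every intermediate set is a cut, so the vertices of `Q` outside `P` can be added in any order.
-/
theorem Reach.extend {P Q : Finset V} (hP : Reach k G P) (hPQ : P ⊆ Q)
    (h : ∀ Z, P ⊆ Z → Z ⊆ Q → Cut k G Z) : Reach k G Q := by
  have key : ∀ R : Finset V, R ⊆ Q → Reach k G (P ∪ R) := by
    intro R
    induction R using Finset.induction_on with
    | empty => intro _; simpa using hP
    | insert a R _ ih =>
      intro hR
      have hRQ : R ⊆ Q := fun x hx => hR (Finset.mem_insert_of_mem hx)
      have e : P ∪ Insert.insert a R = Insert.insert a (P ∪ R) := Finset.union_insert _ _ _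
      rw [e]
      by_cases ha' : a ∈ P ∪ R
      · rw [Finset.insert_eq_of_mem ha']; exact ih hRQ
      · refine Reach.insert a _ ha' (ih hRQ) (h _ ?_ ?_)
        · intro x hx; simp [hx]
        · rw [← e]; exact Finset.union_subset hPQ hR
  have := key Q subset_rfl
  rwa [Finset.union_eq_right.2 hPQ] at this

/-- `P` can be built by an expression in which equally labelled vertices have equal neighbourhoods
outside `P`, and one label is not used. -/
def Built (k : ℕ) (G : SimpleGraph V) (P : Finset V) : Prop :=
  ∃ (t : CWExpr k) (φ : t.Vert → V), Function.Injective φ ∧ (∀ v, v ∈ P ↔ ∃ a, φ a = v) ∧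
    (∀ a b, t.graph.Adj a b ↔ G.Adj (φ a) (φ b)) ∧
    (∀ a b, t.label a = t.label b → ∀ w ∉ P, (G.Adj (φ a) w ↔ G.Adj (φ b) w)) ∧
    ∃ i, ∀ a, t.label a ≠ i

theorem join_adj (i j : Fin k) (hij : i ≠ j) (t : CWExpr k) (a b : t.Vert) :
    (CWExpr.join i j hij t).graph.Adj a b ↔ t.graph.Adj a b ∨ (a ≠ b ∧
      ((t.label a = i ∧ t.label b = j) ∨ (t.label b = i ∧ t.label a = j))) :=
  Iff.rfl

theorem exists_union_single (t : CWExpr k) (f : Fin k) :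
    ∃ (u : CWExpr k) (e : u.Vert ≃ t.Vert ⊕ Unit),
      (∀ a, u.label a = Sum.elim t.label (fun _ => f) (e a)) ∧
      ∀ a b, u.graph.Adj a b ↔ (t.graph ⊕g (⊥ : SimpleGraph Unit)).Adj (e a) (e b) :=
  ⟨CWExpr.union t (CWExpr.single f), Equiv.refl _, fun _ => rfl, fun _ _ => Iff.rfl⟩

/-- Joining one label to a set of other labels. -/
theorem exists_joins (t : CWExpr k) (f : Fin k) (A : Finset (Fin k)) (hf : f ∉ A) :
    ∃ (t' : CWExpr k) (e : t'.Vert ≃ t.Vert), (∀ a, t'.label a = t.label (e a)) ∧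
      ∀ a b, t'.graph.Adj a b ↔ (t.graph.Adj (e a) (e b) ∨
        (t.label (e a) = f ∧ t.label (e b) ∈ A) ∨ (t.label (e b) = f ∧ t.label (e a) ∈ A)) := by
  induction A using Finset.induction_on with
  | empty => exact ⟨t, Equiv.refl _, fun _ => rfl, fun a b => by simp⟩
  | insert i A _ ih =>
    rw [Finset.mem_insert, not_or] at hf
    obtain ⟨t', e, hl, hadj⟩ := ih hf.2
    refine ⟨CWExpr.join f i hf.1 t', e, hl, fun (a b : t'.Vert) => ?_⟩
    refine (join_adj f i hf.1 t' a b).trans ?_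
    simp only [hadj, hl, Finset.mem_insert]
    constructor
    · rintro (h | ⟨-, h⟩) <;> tauto
    · have hne : t.label (e a) ≠ t.label (e b) → a ≠ b := by rintro h rfl; exact h rfl
      rintro (h | ⟨h1, h2 | h2⟩ | ⟨h1, h2 | h2⟩)
      · tauto
      · exact Or.inr ⟨hne fun h => hf.1 (h1.symm.trans (h.trans h2)), Or.inl ⟨h1, h2⟩⟩
      · tauto
      · exact Or.inr ⟨hne fun h => hf.1 (h1.symm.trans (h.symm.trans h2)), Or.inr ⟨h1, h2⟩⟩
      · tauto

theorem Built.singleton (hk : 0 < k) (v : V) : Built (k + 1) G {v} := by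
  refine ⟨CWExpr.single 0, fun _ => v, ?_, ?_, ?_, ?_, ⟨⟨1, by omega⟩, ?_⟩⟩
  · intro a b _
    exact Subsingleton.elim (α := Unit) a b
  · intro w
    simp only [Finset.mem_singleton]
    exact ⟨fun h => ⟨(), h.symm⟩, fun ⟨_, h⟩ => h.symm⟩
  · intro a b
    simp [CWExpr.graph]
  · intros; rfl
  · intro a h
    simp only [CWExpr.label, Fin.ext_iff] at h
    simp at h

/-- The new vertex takes the free label `f` and is joined to the labels of its neighbours; this is
unambiguous because equally labelled vertices agree on `v`, which lies outside `P`. If no label is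
then free, all `k + 1` occur; the cut allows only `k` neighbourhoods, so two labels can be merged.
-/
theorem Built.insert {P : Finset V} {v : V} (hv : v ∉ P) (h : Built (k + 1) G P)
    (hc : Cut k G (insert v P)) : Built (k + 1) G (insert v P) := by
  obtain ⟨t, φ, hinj, hP, hadj, hlab, f, hf⟩ := h
  let A : Finset (Fin (k + 1)) :=
    Finset.univ.filter fun i => ∃ a, t.label a = i ∧ G.Adj (φ a) v
  have hA : ∀ a, t.label a ∈ A ↔ G.Adj (φ a) v := by
    intro a
    simp only [A, Finset.mem_filter, Finset.mem_univ, true_and]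
    exact ⟨fun ⟨b, hb, hbv⟩ => (hlab b a hb v hv).1 hbv, fun h => ⟨a, rfl, h⟩⟩
  have hfA : f ∉ A := by
    simp only [A, Finset.mem_filter, Finset.mem_univ, true_and]
    rintro ⟨a, ha, -⟩
    exact hf a ha
  obtain ⟨u, e₁, hul, huadj⟩ := exists_union_single t f
  obtain ⟨s, e₂, hsl, hsadj⟩ := exists_joins u f A hfA
  let e := e₂.trans e₁
  let ψ₀ : t.Vert ⊕ Unit → V := Sum.elim φ (fun _ => v)
  have hφP : ∀ a, φ a ∈ P := fun a => (hP _).2 ⟨a, rfl⟩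
  have hψ₀ : Function.Injective ψ₀ := by
    rintro (a | a) (b | b) hab
    · exact congrArg _ (hinj hab)
    · exact absurd ((show φ a = v from hab) ▸ hφP a) hv
    · exact absurd ((show v = φ b from hab).symm ▸ hφP b) hv
    · rfl
  let ψ : s.Vert → V := fun a => ψ₀ (e a)
  have hψ : Function.Injective ψ := hψ₀.comp e.injective
  have hrange : ∀ w, w ∈ Insert.insert v P ↔ ∃ a, ψ a = w := by
    intro w
    rw [Finset.mem_insert]
    constructor
    · rintro (rfl | hw)
      · exact ⟨e.symm (Sum.inr ()), by simp [ψ, ψ₀]⟩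
      · obtain ⟨a, rfl⟩ := (hP w).1 hw
        exact ⟨e.symm (Sum.inl a), by simp [ψ, ψ₀]⟩
    · rintro ⟨a, rfl⟩
      rcases he : e a with b | b
      · right; simp only [ψ, he]; exact hφP b
      · left; simp only [ψ, he]; rfl
  have hsadj' : ∀ a b, s.graph.Adj a b ↔ G.Adj (ψ a) (ψ b) := by
    intro a b
    rw [hsadj, huadj, hul, hul]
    change (t.graph ⊕g (⊥ : SimpleGraph Unit)).Adj (e a) (e b) ∨
      (Sum.elim t.label (fun _ => f) (e a) = f ∧ Sum.elim t.label (fun _ => f) (e b) ∈ A) ∨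
      (Sum.elim t.label (fun _ => f) (e b) = f ∧ Sum.elim t.label (fun _ => f) (e a) ∈ A) ↔
      G.Adj (ψ₀ (e a)) (ψ₀ (e b))
    generalize e a = a'
    generalize e b = b'
    rcases a' with a' | a' <;> rcases b' with b' | b'
    · have h1 := hf a'
      have h2 := hf b'
      simp [ψ₀, hadj, h1, h2]
    · have h1 := hf a'
      simp [ψ₀, h1, hA]
    · have h1 := hf b'
      simp [ψ₀, h1, hA, G.adj_comm v]
    · simp [ψ₀, hfA]
  have hslab : ∀ a b, s.label a = s.label b →
      ∀ w ∉ Insert.insert v P, (G.Adj (ψ a) w ↔ G.Adj (ψ b) w) := by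
    intro a b hab w hw
    rw [Finset.mem_insert, not_or] at hw
    rw [hsl, hsl, hul, hul] at hab
    change Sum.elim t.label (fun _ => f) (e a) = Sum.elim t.label (fun _ => f) (e b) at hab
    change G.Adj (ψ₀ (e a)) w ↔ G.Adj (ψ₀ (e b)) w
    generalize e a = a' at hab
    generalize e b = b' at hab
    rcases a' with a' | a' <;> rcases b' with b' | b'
    · exact hlab a' b' hab w hw.2
    · exact absurd hab (hf a')
    · exact absurd hab.symm (hf b')
    · rfl
  by_cases hfree : ∃ i, ∀ a, s.label a ≠ i
  · exact ⟨s, ψ, hψ, hrange, hsadj', hslab, hfree⟩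
  push Not at hfree
  choose r hr using hfree
  obtain ⟨c, hc⟩ := hc
  -- Pigeonhole: `k + 1` label representatives, but only `k` colours.
  obtain ⟨i, j, hij, hcij⟩ := Fintype.exists_ne_map_eq_of_card_lt (fun i => c (ψ (r i))) (by simp)
  have hmem : ∀ a, ψ a ∈ Insert.insert v P := fun a => (hrange _).2 ⟨a, rfl⟩
  have hsame : ∀ a b, s.label a = i → s.label b = j →
      ∀ w ∉ Insert.insert v P, (G.Adj (ψ a) w ↔ G.Adj (ψ b) w) := by
    intro a b ha hb w hw
    rw [hslab a (r i) (by rw [ha, hr]) w hw, hslab b (r j) (by rw [hb, hr]) w hw]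
    exact hc _ (hmem _) _ (hmem _) hcij w hw
  refine ⟨CWExpr.rename i j s, ψ, hψ, hrange, hsadj', ?_, i, ?_⟩
  · intro a b hab w hw
    change (if s.label a = i then j else s.label a) =
      (if s.label b = i then j else s.label b) at hab
    split_ifs at hab with h1 h2 h2
    · exact hslab a b (h1.trans h2.symm) w hw
    · exact hsame a b h1 hab.symm w hw
    · exact (hsame b a h2 hab w hw).symm
    · exact hslab a b hab w hw
  · intro a
    change (if s.label a = i then j else s.label a) ≠ i
    split_ifs with h1
    · exact Ne.symm hij
    · exact h1

theorem Reach.built {P : Finset V} (h : Reach k G P) : P = ∅ ∨ Built (k + 1) G P := by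
  induction h with
  | empty => exact Or.inl rfl
  | insert v P hv _ hc ih =>
    right
    rcases ih with rfl | ih
    · obtain ⟨c, -⟩ := hc
      simpa using Built.singleton (c v).pos v
    · exact ih.insert hv hc

theorem Reach.cliqueWidth_le [Fintype V] (h : Reach k G Finset.univ) :
    cliqueWidth G ≤ ((k + 1 : ℕ) : ℕ∞) := by
  refine iInf₂_le (k + 1) ?_
  rcases h.built with h | ⟨t, φ, hinj, hP, hadj, -⟩
  · exact Or.inl (Finset.univ_eq_empty_iff.1 h)
  · have hsurj : Function.Surjective φ := fun v => (hP v).1 (Finset.mem_univ v)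
    exact Or.inr ⟨t, ⟨⟨Equiv.ofBijective φ ⟨hinj, hsurj⟩, fun {a b} => (hadj a b).symm⟩⟩⟩

end Basic

/-! ### Adjacency between two cliques or independent sets -/

/-- No vertices `a, b` and path `x, y, z` induce a copy of `2P₁ + P₃`. -/
def HFree {V : Type u} (G : SimpleGraph V) : Prop :=
  ∀ a b x y z : V, a ≠ b → ¬ G.Adj a b → x ≠ z → ¬ G.Adj x z → G.Adj x y → G.Adj y z →
    ¬ G.Adj a x → ¬ G.Adj a y → ¬ G.Adj a z → ¬ G.Adj b x → ¬ G.Adj b y → ¬ G.Adj b z → False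

/-- Neither `G` nor its complement has an induced `2P₁ + P₃`. -/
structure Tame {V : Type u} (G : SimpleGraph V) : Prop where
  hfree : HFree G
  cofree : HFree Gᶜ

/-- `G` has an induced `5P₁ + 3P₂`. -/
def HasU {V : Type u} (G : SimpleGraph V) : Prop :=
  ∃ (I : Finset V) (x y : Fin 3 → V), I.card = 5 ∧ G.IsIndepSet I ∧ (∀ j, G.Adj (x j) (y j)) ∧
    (∀ j, ∀ i ∈ I, ¬ G.Adj (x j) i ∧ ¬ G.Adj (y j) i) ∧
    ∀ j k, j ≠ k → ¬ G.Adj (x j) (x k) ∧ ¬ G.Adj (x j) (y k) ∧ ¬ G.Adj (y j) (y k)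

open Classical in
/-- The elements of `Y` whose adjacency to `x` is not given by `b`. -/
noncomputable def devs {V : Type u} (G : SimpleGraph V) (b : Prop) (x : V) (Y : Finset V) :
    Finset V :=
  Y.filter fun y => ¬ (G.Adj x y ↔ b)

/-- Outside `E`, the adjacency between `X` and `Y` is given by `b` up to a matching, and
exactly by `b` unless `X` and `Y` are both independent and `b` holds, or are both cliques and `b`
fails. -/
structure PairOK {V : Type u} (G : SimpleGraph V) (X Y E : Finset V) (b : Prop) : Prop where
  left : ∀ x ∈ X, x ∉ E → (devs G b x Y).card ≤ 1
  right : ∀ y ∈ Y, y ∉ E → (devs G b y X).card ≤ 1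
  dev : ∀ x ∈ X, x ∉ E → ∀ y ∈ Y, y ∉ E → ¬ (G.Adj x y ↔ b) →
    (b ∧ G.IsIndepSet (X : Set V) ∧ G.IsIndepSet (Y : Set V)) ∨
      (¬ b ∧ G.IsClique (X : Set V) ∧ G.IsClique (Y : Set V))

section Pairs

open Classical

variable {V : Type u} {G : SimpleGraph V}

theorem Tame.compl (h : Tame G) : Tame Gᶜ := ⟨h.cofree, by rw [compl_compl]; exact h.hfree⟩

/-- The complement of `2P₁ + P₃` consists of two adjacent vertices `p, q`, both adjacent to the
three vertices `c, d, e` of a `P₂ + P₁`. -/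
theorem Tame.cofree' (h : Tame G) {p q c d e : V} (hpq : G.Adj p q) (hcd : G.Adj c d)
    (hce : c ≠ e) (hce' : ¬ G.Adj c e) (hde : d ≠ e) (hde' : ¬ G.Adj d e)
    (hpc : G.Adj p c) (hpd : G.Adj p d) (hpe : G.Adj p e)
    (hqc : G.Adj q c) (hqd : G.Adj q d) (hqe : G.Adj q e) : False := by
  refine h.cofree p q c e d hpq.ne ?_ hcd.ne ?_ ?_ ?_ ?_ ?_ ?_ ?_ ?_ ?_ <;>
    simp_all [SimpleGraph.compl_adj, G.adj_comm e d, Ne.symm]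

theorem mem_devs {b : Prop} {x y : V} {Y : Finset V} :
    y ∈ devs G b x Y ↔ y ∈ Y ∧ ¬ (G.Adj x y ↔ b) := by
  simp [devs]

theorem devs_compl {b : Prop} {x : V} {Y : Finset V} (hx : x ∉ Y) :
    devs Gᶜ b x Y = devs G (¬ b) x Y := by
  ext y
  simp only [mem_devs, SimpleGraph.compl_adj]
  have : y ∈ Y → x ≠ y := by rintro h rfl; exact hx h
  tauto

theorem adj_iff_of_devs {b : Prop} {x y : V} {Y : Finset V} (h : (devs G b x Y).card ≤ 1)
    (hy : y ∈ Y) (hxy : ¬ (G.Adj x y ↔ b)) {z : V} (hz : z ∈ Y) (hzy : z ≠ y) :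
    (G.Adj x z ↔ b) := by
  by_contra hc
  exact hzy (Finset.card_le_one.1 h z (mem_devs.2 ⟨hz, hc⟩) y (mem_devs.2 ⟨hy, hxy⟩))

theorem exists_mem_avoid {X S : Finset V} (h : S.card < X.card) : ∃ x ∈ X, x ∉ S :=
  Finset.exists_mem_notMem_of_card_lt_card h

theorem exists_two_avoid {X S : Finset V} (h : S.card + 1 < X.card) :
    ∃ x ∈ X, ∃ y ∈ X, x ∉ S ∧ y ∉ S ∧ x ≠ y := by
  have : 1 < (X \ S).card := by
    have := Finset.le_card_sdiff S X
    omega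
  obtain ⟨x, hx, y, hy, hxy⟩ := Finset.one_lt_card.1 this
  rw [Finset.mem_sdiff] at hx hy
  exact ⟨x, hx.1, y, hy.1, hx.2, hy.2, hxy⟩

/-- The sparse/dense dichotomy: `devs G False v X` holds the neighbours of `v` and `devs G True v X`
the non-neighbours. Two neighbours form a `P₃` with `v` in the middle, and two non-neighbours supply
the `2P₁`. -/
theorem devs_card_of_indep (h : HFree G) {X : Finset V} (hX : G.IsIndepSet (X : Set V)) (v : V) :
    (devs G False v X).card ≤ 1 ∨ (devs G True v X).card ≤ 1 := by
  by_contra! hc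
  obtain ⟨x, hx, z, hz, hxz⟩ := Finset.one_lt_card.1 hc.1
  obtain ⟨a, ha, b, hb, hab⟩ := Finset.one_lt_card.1 hc.2
  simp only [mem_devs, iff_false, iff_true, not_not] at hx hz ha hb
  have hI : ∀ p ∈ X, ∀ q ∈ X, ¬ G.Adj p q := fun p hp q hq hpq =>
    hX (Finset.mem_coe.2 hp) (Finset.mem_coe.2 hq) hpq.ne hpq
  exact h a b x v z hab (hI _ ha.1 _ hb.1) hxz (hI _ hx.1 _ hz.1) hx.2.symm hz.2
    (hI _ ha.1 _ hx.1) (fun h => ha.2 h.symm) (hI _ ha.1 _ hz.1)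
    (hI _ hb.1 _ hx.1) (fun h => hb.2 h.symm) (hI _ hb.1 _ hz.1)

theorem Tame.devs_card (h : Tame G) {X : Finset V}
    (hX : G.IsClique (X : Set V) ∨ G.IsIndepSet (X : Set V)) {v : V} (hv : v ∉ X) :
    (devs G False v X).card ≤ 1 ∨ (devs G True v X).card ≤ 1 := by
  rcases hX with hX | hX
  · have := devs_card_of_indep h.cofree ((isIndepSet_compl G).2 hX) v
    rw [devs_compl hv, devs_compl hv] at this
    simpa [or_comm] using this
  · exact devs_card_of_indep h.hfree hX v

theorem PairOK.symm {X Y E : Finset V} {b : Prop} (h : PairOK G X Y E b) : PairOK G Y X E b :=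
  ⟨h.right, h.left, fun y hy hyE x hx hxE hxy =>
    (h.dev x hx hxE y hy hyE (by rwa [G.adj_comm])).imp (fun h => ⟨h.1, h.2.2, h.2.1⟩)
      fun h => ⟨h.1, h.2.2, h.2.1⟩⟩

theorem PairOK.of_compl {X Y E : Finset V} {b : Prop} (hd : Disjoint X Y)
    (h : PairOK Gᶜ X Y E (¬ b)) : PairOK G X Y E b := by
  have hX : ∀ x ∈ X, x ∉ Y := fun x hx hy => Finset.disjoint_left.1 hd hx hy
  have hY : ∀ x ∈ Y, x ∉ X := fun x hx hy => Finset.disjoint_left.1 hd hy hx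
  refine ⟨fun x hx hE => ?_, fun y hy hE => ?_, fun x hx hxE y hy hyE hxy => ?_⟩
  · simpa [devs_compl (hX x hx)] using h.left x hx hE
  · simpa [devs_compl (hY y hy)] using h.right y hy hE
  · have hne : x ≠ y := by rintro rfl; exact hX x hx hy
    have := h.dev x hx hxE y hy hyE (by rw [SimpleGraph.compl_adj]; tauto)
    rw [isClique_compl, isClique_compl, isIndepSet_compl, isIndepSet_compl, not_not] at this
    tauto

/-- Three sparse vertices on one side exclude three dense ones on the other. -/
theorem not_three_three {S T : Finset V} (hS : S.card = 3) (hT : T.card = 3)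
    (h1 : ∀ x ∈ S, (devs G False x T).card ≤ 1) (h2 : ∀ y ∈ T, (devs G True y S).card ≤ 1) :
    False := by
  -- Double counting: of the nine pairs, at most three are adjacent and at most three are not.
  have e1 : ∑ x ∈ S, (devs G False x T).card ≤ 3 := by
    simpa [hS] using Finset.sum_le_card_nsmul S _ 1 h1
  have e2 : ∑ y ∈ T, (devs G True y S).card ≤ 3 := by
    simpa [hT] using Finset.sum_le_card_nsmul T _ 1 h2
  have e3 : ∑ y ∈ T, (devs G True y S).card = ∑ x ∈ S, (T.filter fun y => ¬ G.Adj x y).card := by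
    simp only [devs, iff_true, Finset.card_filter]
    rw [Finset.sum_comm]
    simp only [G.adj_comm]
  have e4 : ∑ x ∈ S, ((devs G False x T).card + (T.filter fun y => ¬ G.Adj x y).card) = 9 := by
    have : ∀ x ∈ S, (devs G False x T).card + (T.filter fun y => ¬ G.Adj x y).card = 3 := by
      intro x _
      simp only [devs, iff_false, not_not]
      rw [Finset.card_filter_add_card_filter_not, hT]
    rw [Finset.sum_congr rfl this, Finset.sum_const, hS]
    rfl
  rw [Finset.sum_add_distrib] at e4
  omega

theorem devs_mono {b : Prop} {x : V} {S T : Finset V} (h : S ⊆ T) :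
    (devs G b x S).card ≤ (devs G b x T).card :=
  Finset.card_le_card fun _ hy => mem_devs.2 ⟨h (mem_devs.1 hy).1, (mem_devs.1 hy).2⟩

theorem few_dense {X Y : Finset V}
    (hX : 3 ≤ (X.filter fun x => (devs G False x Y).card ≤ 1).card) :
    (Y.filter fun y => (devs G True y X).card ≤ 1).card ≤ 2 := by
  by_contra! hc
  obtain ⟨S, hS, hS3⟩ := Finset.exists_subset_card_eq hX
  obtain ⟨T, hT, hT3⟩ := Finset.exists_subset_card_eq hc
  refine not_three_three (G := G) hS3 hT3 (fun x hx => ?_) fun y hy => ?_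
  · exact (devs_mono (hT.trans (Finset.filter_subset _ _))).trans (Finset.mem_filter.1 (hS hx)).2
  · exact (devs_mono (hS.trans (Finset.filter_subset _ _))).trans (Finset.mem_filter.1 (hT hy)).2

theorem not_adj_of_devs {x y z : V} {Y : Finset V} (h : (devs G False x Y).card ≤ 1)
    (hy : y ∈ Y) (hxy : G.Adj x y) (hz : z ∈ Y) (hzy : z ≠ y) : ¬ G.Adj x z := by
  simpa using adj_iff_of_devs h hy (by simpa using hxy) hz hzy

theorem indep_not_adj {X : Finset V} (hX : G.IsIndepSet (X : Set V)) {x y : V} (hx : x ∈ X)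
    (hy : y ∈ X) : ¬ G.Adj x y :=
  fun h => hX (Finset.mem_coe.2 hx) (Finset.mem_coe.2 hy) h.ne h

/-- Given an edge `x y`, another clique vertex `x'` is not adjacent to `y`, so `x' x y` is an
induced path. Two further vertices of `Y` avoid the neighbours of `x` and `x'` and complete a `2P₁ +
P₃`. -/
theorem not_adj_of_clique_of_indep (hG : HFree G) {X Y A B : Finset V}
    (hX : G.IsClique (X : Set V)) (hY : G.IsIndepSet (Y : Set V))
    (hXA : A.card + 2 < X.card) (hY4 : 4 ≤ Y.card)
    (hA : ∀ x ∈ X, x ∉ A → (devs G False x Y).card ≤ 1)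
    (hB : ∀ y ∈ Y, y ∉ B → (devs G False y X).card ≤ 1) {x y : V} (hx : x ∈ X) (hxA : x ∉ A)
    (hy : y ∈ Y) (hyB : y ∉ B) : ¬ G.Adj x y := by
  intro hxy
  obtain ⟨x', hx', hx'S⟩ : ∃ x' ∈ X, x' ∉ insert x (insert y A) :=
    exists_mem_avoid (lt_of_le_of_lt ((Finset.card_insert_le _ _).trans
      (Nat.succ_le_succ (Finset.card_insert_le _ _))) hXA)
  rw [Finset.mem_insert, not_or, Finset.mem_insert, not_or] at hx'S
  have hx'y : ¬ G.Adj x' y := fun h =>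
    not_adj_of_devs (hB y hy hyB) hx hxy.symm hx' hx'S.1 h.symm
  have hc := hA x' hx' hx'S.2.2
  obtain ⟨a, ha, b, hb, haS, hbS, hab⟩ : ∃ a ∈ Y, ∃ b ∈ Y, a ∉ insert y (devs G False x' Y) ∧
      b ∉ insert y (devs G False x' Y) ∧ a ≠ b :=
    exists_two_avoid (by have := Finset.card_insert_le y (devs G False x' Y); omega)
  simp only [Finset.mem_insert, mem_devs, iff_false, not_not, not_or, not_and] at haS hbS
  have hxs := hA x hx hxA
  exact hG a b x' x y hab (indep_not_adj hY ha hb) hx'S.2.1 hx'y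
    (hX (Finset.mem_coe.2 hx') (Finset.mem_coe.2 hx) hx'S.1) hxy
    (fun h => haS.2 ha h.symm)
    (fun h => not_adj_of_devs hxs hy hxy ha haS.1 h.symm)
    (indep_not_adj hY ha hy) (fun h => hbS.2 hb h.symm)
    (fun h => not_adj_of_devs hxs hy hxy hb hbS.1 h.symm) (indep_not_adj hY hb hy)

/-- Three such vertices with their partners form `3P₂`, since each partner has only one neighbour in
`X`; five more vertices of `X` complete `5P₁ + 3P₂`. -/
theorem card_matched_le (hU : ¬ HasU G) {X Y A B : Finset V}
    (hX : G.IsIndepSet (X : Set V)) (hY : G.IsIndepSet (Y : Set V))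
    (hX20 : A.card + 8 ≤ X.card)
    (hB : ∀ y ∈ Y, y ∉ B → (devs G False y X).card ≤ 1) :
    (X.filter fun x => x ∉ A ∧ ∃ y ∈ Y, y ∉ B ∧ G.Adj x y).card ≤ 2 := by
  by_contra! hc
  obtain ⟨S, hS, hS3⟩ := Finset.exists_subset_card_eq (Nat.succ_le_of_lt hc)
  let f := S.equivFinOfCardEq hS3
  let x : Fin 3 → V := fun j => (f.symm j : V)
  have hxS : ∀ j, x j ∈ S := fun j => (f.symm j).2
  have hx : ∀ j, x j ∈ X ∧ x j ∉ A ∧ ∃ y ∈ Y, y ∉ B ∧ G.Adj (x j) y :=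
    fun j => Finset.mem_filter.1 (hS (hxS j))
  have hxinj : ∀ j k, j ≠ k → x j ≠ x k := fun j k hjk h =>
    hjk (f.symm.injective (Subtype.ext h))
  choose y hyY hyB hxy using fun j => (hx j).2.2
  have hy : ∀ j, ∀ z ∈ X, z ≠ x j → ¬ G.Adj (y j) z := fun j z hz hzx =>
    not_adj_of_devs (hB _ (hyY j) (hyB j)) (hx j).1 (hxy j).symm hz hzx
  have hXS : 5 ≤ (X \ S).card := by
    have := Finset.le_card_sdiff S X
    omega
  obtain ⟨I, hI, hI5⟩ := Finset.exists_subset_card_eq hXS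
  have hIX : ∀ i ∈ I, i ∈ X ∧ i ∉ S := fun i hi => Finset.mem_sdiff.1 (hI hi)
  refine hU ⟨I, x, y, hI5, ?_, hxy, ?_, ?_⟩
  · intro i hi j hj _
    exact indep_not_adj hX (hIX i hi).1 (hIX j hj).1
  · intro j i hi
    exact ⟨indep_not_adj hX (hx j).1 (hIX i hi).1,
      hy j i (hIX i hi).1 fun h => (hIX i hi).2 (h ▸ hxS j)⟩
  · intro j k hjk
    exact ⟨indep_not_adj hX (hx j).1 (hx k).1, fun h => hy k _ (hx j).1 (hxinj j k hjk) h.symm,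
      indep_not_adj hY (hyY j) (hyY k)⟩

/-- The case of a sparse pair. -/
theorem pairOK_of_sparse (hG : Tame G) {X Y : Finset V} (hXY : Disjoint X Y)
    (hX : G.IsClique (X : Set V) ∨ G.IsIndepSet (X : Set V))
    (hY : G.IsClique (Y : Set V) ∨ G.IsIndepSet (Y : Set V))
    (hX20 : 20 ≤ X.card) (hY20 : 20 ≤ Y.card)
    (hU : ¬ HasU G ∨ ¬ (G.IsIndepSet (X : Set V) ∧ G.IsIndepSet (Y : Set V)))
    (hs : 3 ≤ (X.filter fun x => (devs G False x Y).card ≤ 1).card) :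
    ∃ E : Finset V, E.card ≤ 6 ∧ PairOK G X Y E False := by
  have hXY' : ∀ x ∈ X, x ∉ Y := fun x hx hy => Finset.disjoint_left.1 hXY hx hy
  have hYX' : ∀ y ∈ Y, y ∉ X := fun x hx hy => Finset.disjoint_left.1 hXY hy hx
  -- The dense vertices, at most two on each side. Between two independent sets, at most two further
  -- vertices of `X` carry edges, which gives the bound six.
  let A := X.filter fun x => ¬ (devs G False x Y).card ≤ 1
  let B := Y.filter fun y => ¬ (devs G False y X).card ≤ 1
  have hBle : B.card ≤ 2 := by
    refine (Finset.card_le_card fun y hy => ?_).trans (few_dense hs)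
    rw [Finset.mem_filter] at hy ⊢
    exact ⟨hy.1, (hG.devs_card hX (hYX' y hy.1)).resolve_left hy.2⟩
  have hAle : A.card ≤ 2 := by
    have hs' : 3 ≤ (Y.filter fun y => (devs G False y X).card ≤ 1).card := by
      have := Finset.card_filter_add_card_filter_not (s := Y)
        fun y => (devs G False y X).card ≤ 1
      change _ + B.card = _ at this
      omega
    refine (Finset.card_le_card fun x hx => ?_).trans (few_dense hs')
    rw [Finset.mem_filter] at hx ⊢
    exact ⟨hx.1, (hG.devs_card hY (hXY' x hx.1)).resolve_left hx.2⟩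
  have hA : ∀ x ∈ X, x ∉ A → (devs G False x Y).card ≤ 1 := fun x hx hxA => by
    by_contra h
    exact hxA (Finset.mem_filter.2 ⟨hx, h⟩)
  have hB : ∀ y ∈ Y, y ∉ B → (devs G False y X).card ≤ 1 := fun y hy hyB => by
    by_contra h
    exact hyB (Finset.mem_filter.2 ⟨hy, h⟩)
  have hcard : (A ∪ B).card ≤ 4 := (Finset.card_union_le _ _).trans (by omega)
  by_cases hind : G.IsIndepSet (X : Set V) ∧ G.IsIndepSet (Y : Set V)
  · have hN := card_matched_le (A := A) (B := B) (hU.resolve_right (not_not_intro hind))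
      hind.1 hind.2 (by omega) hB
    refine ⟨(A ∪ B) ∪ X.filter fun x => x ∉ A ∧ ∃ y ∈ Y, y ∉ B ∧ G.Adj x y,
      (Finset.card_union_le _ _).trans (by omega), ?_, ?_, ?_⟩
    · intro x hx hxE
      exact hA x hx (by simp only [Finset.mem_union] at hxE; tauto)
    · intro y hy hyE
      exact hB y hy (by simp only [Finset.mem_union] at hyE; tauto)
    · intro x hx hxE y hy hyE hxy
      exfalso
      simp only [Finset.mem_union, Finset.mem_filter, not_or, not_and, not_exists] at hxE hyE
      rw [iff_false, not_not] at hxy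
      exact hxE.2 hx hxE.1.1 y hy hyE.1.2 hxy
  · refine ⟨A ∪ B, by omega, ?_, ?_, ?_⟩
    · intro x hx hxE
      exact hA x hx (by simp only [Finset.mem_union] at hxE; tauto)
    · intro y hy hyE
      exact hB y hy (by simp only [Finset.mem_union] at hyE; tauto)
    · intro x hx hxE y hy hyE hxy
      rw [iff_false, not_not] at hxy
      rw [Finset.mem_union, not_or] at hxE hyE
      rcases hX with hX | hX <;> rcases hY with hY | hY
      · exact Or.inr ⟨not_false, hX, hY⟩
      · exact absurd hxy (not_adj_of_clique_of_indep hG.hfree hX hY (by omega) (by omega) hA hB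
          hx hxE.1 hy hyE.2)
      · exact absurd hxy.symm (not_adj_of_clique_of_indep hG.hfree hY hX (by omega) (by omega)
          hB hA hy hyE.2 hx hxE.1)
      · exact absurd ⟨hX, hY⟩ hind

/-- If fewer than three vertices of `X` are sparse towards `Y`, then at least three are dense, and
the sparse case applies to the complement. The exclusion of `5P₁ + 3P₂` matters only for two sets of
the same kind. -/
theorem exists_pairOK (hG : Tame G) {X Y : Finset V} (hXY : Disjoint X Y)
    (hX : G.IsClique (X : Set V) ∨ G.IsIndepSet (X : Set V))
    (hY : G.IsClique (Y : Set V) ∨ G.IsIndepSet (Y : Set V))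
    (hX20 : 20 ≤ X.card) (hY20 : 20 ≤ Y.card)
    (hU : ¬ HasU G ∨ ¬ (G.IsIndepSet (X : Set V) ∧ G.IsIndepSet (Y : Set V)))
    (hU' : ¬ HasU Gᶜ ∨ ¬ (G.IsClique (X : Set V) ∧ G.IsClique (Y : Set V))) :
    ∃ (E : Finset V) (b : Prop), E.card ≤ 6 ∧ PairOK G X Y E b := by
  by_cases hs : 3 ≤ (X.filter fun x => (devs G False x Y).card ≤ 1).card
  · obtain ⟨E, hE, h⟩ := pairOK_of_sparse hG hXY hX hY hX20 hY20 hU hs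
    exact ⟨E, False, hE, h⟩
  · have hXY' : ∀ x ∈ X, x ∉ Y := fun x hx hy => Finset.disjoint_left.1 hXY hx hy
    have hs' : 3 ≤ (X.filter fun x => (devs Gᶜ False x Y).card ≤ 1).card := by
      have hsub : X \ (X.filter fun x => (devs G False x Y).card ≤ 1) ⊆
          X.filter fun x => (devs Gᶜ False x Y).card ≤ 1 := by
        intro x hx
        rw [Finset.mem_sdiff, Finset.mem_filter] at hx
        rw [Finset.mem_filter, devs_compl (hXY' x hx.1), not_false_eq_true]
        exact ⟨hx.1, (hG.devs_card hY (hXY' x hx.1)).resolve_left fun h => hx.2 ⟨hx.1, h⟩⟩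
      have h1 := Finset.card_le_card hsub
      have h2 := Finset.le_card_sdiff (X.filter fun x => (devs G False x Y).card ≤ 1) X
      omega
    obtain ⟨E, hE, h⟩ := pairOK_of_sparse hG.compl hXY
      (by rw [isClique_compl, isIndepSet_compl]; exact hX.symm)
      (by rw [isClique_compl, isIndepSet_compl]; exact hY.symm) hX20 hY20
      (by rw [isIndepSet_compl, isIndepSet_compl]; exact hU') hs'
    exact ⟨E, True, hE, PairOK.of_compl hXY (by simpa using h)⟩

end Pairs

/-! ### Graphs containing an induced `5P₁ + 3P₂` -/

/-- `S` induces a disjoint union of cliques, the other vertices are independent, and the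
non-neighbours in `S` of any of them form a clique. -/
structure CliquesAndIndep {V : Type u} (G : SimpleGraph V) (S : Finset V) : Prop where
  trans : ∀ x ∈ S, ∀ y ∈ S, ∀ z ∈ S, G.Adj x y → G.Adj y z → x ≠ z → G.Adj x z
  indep : ∀ v ∉ S, ∀ w ∉ S, ¬ G.Adj v w
  nonadj : ∀ v ∉ S, ∀ x ∈ S, ∀ y ∈ S, ¬ G.Adj v x → ¬ G.Adj v y → x ≠ y → G.Adj x y

/-- `P` is a union of components of `S` together with all other vertices that are not complete to
these components, or that are complete to `S`. -/
structure ClosedIn {V : Type u} (G : SimpleGraph V) (S P : Finset V) : Prop where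
  comp : ∀ x ∈ P, x ∈ S → ∀ y ∈ S, G.Adj x y → y ∈ P
  outside : ∀ v ∉ P, v ∉ S → ∀ x ∈ P, x ∈ S → G.Adj v x
  inside : ∀ v ∈ P, v ∉ S → ∀ x ∉ P, x ∈ S → G.Adj v x
  full : ∀ v ∉ S, (∀ x ∈ S, G.Adj v x) → v ∈ P

section Split

open Classical

variable {V : Type u} {G : SimpleGraph V}

/-- A clique and an independent set are completely joined or anticomplete, up to few vertices. -/
theorem exists_uniform (hG : Tame G) {C B : Finset V} (hCB : Disjoint C B)
    (hC : G.IsClique (C : Set V)) (hB : G.IsIndepSet (B : Set V)) :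
    ∃ (E : Finset V) (b : Prop), E.card ≤ 20 ∧
      ∀ x ∈ C, x ∉ E → ∀ y ∈ B, y ∉ E → (G.Adj x y ↔ b) := by
  -- A small set is made exceptional as a whole. For large sets of different kinds, `PairOK` permits
  -- no deviation.
  by_cases hC20 : C.card ≤ 20
  · exact ⟨C, True, hC20, fun x hx hxE => absurd hx hxE⟩
  by_cases hB20 : B.card ≤ 20
  · exact ⟨B, True, hB20, fun x _ _ y hy hyE => absurd hy hyE⟩
  have hC' : ¬ G.IsIndepSet (C : Set V) := by
    intro h
    obtain ⟨x, hx, y, hy, hxy⟩ := Finset.one_lt_card.1 (show 1 < C.card by omega)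
    exact h hx hy hxy (hC hx hy hxy)
  have hB' : ¬ G.IsClique (B : Set V) := by
    intro h
    obtain ⟨x, hx, y, hy, hxy⟩ := Finset.one_lt_card.1 (show 1 < B.card by omega)
    exact hB hx hy hxy (h hx hy hxy)
  obtain ⟨E, b, hE, h⟩ := exists_pairOK hG hCB (Or.inl hC) (Or.inr hB) (by omega) (by omega)
    (Or.inr fun h => hC' h.1) (Or.inr fun h => hB' h.2)
  refine ⟨E, b, by omega, fun x hx hxE y hy hyE => ?_⟩
  by_contra hxy
  rcases h.dev x hx hxE y hy hyE hxy with h | h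
  · exact hC' h.2.1
  · exact hB' h.2.2

variable [Fintype V]

/-- The component `C` of `s` is added together with the set `B` of missing outside vertices that are
not complete to `C`. The non-neighbours in `S` of a vertex of `B` form a clique, so they all lie in
`C`. As `C` and `B` are uniformly joined outside `E`, four types and at most twenty exceptions
suffice: `84 = 21 * 4`. -/
theorem ClosedIn.exists_reach (hG : Tame G) {S P : Finset V} (hS : CliquesAndIndep G S)
    (hP : ClosedIn G S P) (hR : Reach 84 G P) {s : V} (hs : s ∈ S) (hsP : s ∉ P) :
    ∃ Q, P ⊆ Q ∧ s ∈ Q ∧ ClosedIn G S Q ∧ Reach 84 G Q := by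
  let C := S.filter fun x => x = s ∨ G.Adj s x
  let B := Finset.univ.filter fun v => v ∉ S ∧ v ∉ P ∧ ∃ x ∈ C, ¬ G.Adj v x
  have memC : ∀ {x}, x ∈ C ↔ x ∈ S ∧ (x = s ∨ G.Adj s x) := by simp [C]
  have memB : ∀ {v}, v ∈ B ↔ v ∉ S ∧ v ∉ P ∧ ∃ x ∈ C, ¬ G.Adj v x := by simp [B]
  have hCP : ∀ x ∈ C, x ∉ P := by
    intro x hx hxP
    rw [memC] at hx
    rcases hx.2 with rfl | h
    · exact hsP hxP
    · exact hsP (hP.comp x hxP hx.1 s hs h.symm)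
  have hC : ∀ x ∈ C, ∀ y ∈ C, x ≠ y → G.Adj x y := by
    intro x hx y hy hxy
    rw [memC] at hx hy
    rcases hx.2 with rfl | h <;> rcases hy.2 with rfl | h'
    · exact absurd rfl hxy
    · exact h'
    · exact h.symm
    · exact hS.trans x hx.1 s hs y hy.1 h.symm h' hxy
  have hCcomp : ∀ x ∈ C, ∀ y ∈ S, G.Adj x y → y ∈ C := by
    intro x hx y hy hxy
    rw [memC] at hx ⊢
    refine ⟨hy, ?_⟩
    rcases hx.2 with rfl | h
    · exact Or.inr hxy
    · by_cases hys : y = s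
      · exact Or.inl hys
      · exact Or.inr (hS.trans s hs x hx.1 y hy h hxy (Ne.symm hys))
  have hBC : ∀ v ∈ B, ∀ x ∈ S, ¬ G.Adj v x → x ∈ C := by
    intro v hv x hx hvx
    obtain ⟨hvS, -, y, hy, hvy⟩ := memB.1 hv
    by_cases hxy : x = y
    · exact hxy ▸ hy
    · exact hCcomp y hy x hx (hS.nonadj v hvS y (memC.1 hy).1 x hx hvy hvx (Ne.symm hxy))
  obtain ⟨E, b, hE, hunif⟩ := exists_uniform hG (C := C) (B := B)
    (Finset.disjoint_left.2 fun x hx hxB => (memB.1 hxB).1 (memC.1 hx).1)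
    (fun x hx y hy hxy => hC x hx y hy hxy)
    (fun x hx y hy _ => hS.indep x (memB.1 hx).1 y (memB.1 hy).1)
  -- The exceptional vertices enter first, so a new unexceptional vertex of `Z` never faces an
  -- exceptional vertex of `C ∪ B` outside `Z`.
  have hcut : ∀ Z, P ⊆ Z → Z ⊆ P ∪ (C ∪ B) → (Z ⊆ P ∪ E ∨ E ∩ (C ∪ B) ⊆ Z) →
      Cut 84 G Z := by
    intro Z hPZ hZ hEZ
    have hxCB : ∀ x ∈ Z, x ∉ P → (x ∈ S → x ∈ C) ∧ (x ∉ S → x ∈ B) := by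
      intro x hx hxP
      rcases Finset.mem_union.1 (hZ hx) with h | h
      · exact absurd h hxP
      rcases Finset.mem_union.1 h with h | h
      · exact ⟨fun _ => h, fun h' => absurd (memC.1 h).1 h'⟩
      · exact ⟨fun h' => absurd h' (memB.1 h).1, fun _ => h⟩
    have hEw : ∀ x ∈ Z, x ∉ P → x ∉ E → ∀ w ∉ Z, (w ∈ C ∨ w ∈ B) → w ∉ E := by
      intro x hx hxP hxE w hw hwCB hwE
      rcases hEZ with h | h
      · rcases Finset.mem_union.1 (h hx) with h | h
        · exact hxP h
        · exact hxE h
      · exact hw (h (Finset.mem_inter.2 ⟨hwE, Finset.mem_union.2 hwCB⟩))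
    -- The right-hand side depends on `x` only through membership in `P` and in `S`.
    have key : ∀ x ∈ Z, x ∉ E → ∀ w ∉ Z, (G.Adj x w ↔
        if x ∈ P then (x ∈ S ↔ w ∉ S) else
          if x ∈ S then (w ∈ S ∧ w ∈ C) ∨ (w ∉ S ∧ (w ∈ B → b)) else w ∈ S ∧ (w ∈ C → b)) := by
      intro x hx hxE w hw
      have hwP : w ∉ P := fun h => hw (hPZ h)
      by_cases hxP : x ∈ P <;> by_cases hxS : x ∈ S <;> by_cases hwS : w ∈ S <;>
        simp only [hxP, hxS, hwS, if_true, if_false, not_true, not_false_iff, iff_true, iff_false,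
          true_and, false_and, or_false, false_or]
      · exact fun h => hwP (hP.comp x hxP hxS w hwS h)
      · exact (hP.outside w hwP hwS x hxP hxS).symm
      · exact hP.inside x hxP hxS w hwP hwS
      · exact hS.indep x hxS w hwS
      · have hxC := (hxCB x hx hxP).1 hxS
        exact ⟨hCcomp x hxC w hwS, fun hwC => hC x hxC w hwC (by rintro rfl; exact hw hx)⟩
      · have hxC := (hxCB x hx hxP).1 hxS
        by_cases hwB : w ∈ B
        · simp only [hwB, true_imp_iff]
          exact hunif x hxC hxE w hwB (hEw x hx hxP hxE w hw (Or.inr hwB))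
        · simp only [hwB, false_imp_iff, iff_true]
          by_contra h
          exact hwB (memB.2 ⟨hwS, hwP, x, hxC, fun h' => h h'.symm⟩)
      · have hxB := (hxCB x hx hxP).2 hxS
        by_cases hwC : w ∈ C
        · simp only [hwC, true_imp_iff]
          rw [G.adj_comm]
          exact hunif w hwC (hEw x hx hxP hxE w hw (Or.inl hwC)) x hxB hxE
        · simp only [hwC, false_imp_iff, iff_true]
          by_contra h
          exact hwC (hBC x hxB w hwS h)
      · exact hS.indep x hxS w hwS
    refine Cut.of_colouring (E := E) (fun v => (decide (v ∈ P), decide (v ∈ S))) ?_ ?_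
    · have : Fintype.card (Bool × Bool) = 4 := rfl
      rw [this]
      omega
    · intro x hx y hy hxE hyE hxy w hw
      simp only [Prod.mk.injEq, decide_eq_decide] at hxy
      rw [key x hx hxE w hw, key y hy hyE w hw]
      simp only [hxy]
  refine ⟨P ∪ (C ∪ B), Finset.subset_union_left, ?_, ?_, ?_⟩
  · simp [memC, hs]
  · constructor
    · intro x hx hxS y hy hxy
      simp only [Finset.mem_union] at hx ⊢
      rcases hx with hx | hx | hx
      · exact Or.inl (hP.comp x hx hxS y hy hxy)
      · exact Or.inr (Or.inl (hCcomp x hx y hy hxy))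
      · exact absurd hxS (memB.1 hx).1
    · intro v hv hvS x hx hxS
      simp only [Finset.mem_union, not_or] at hv hx
      rcases hx with hx | hx | hx
      · exact hP.outside v hv.1 hvS x hx hxS
      · by_contra h
        exact hv.2.2 (memB.2 ⟨hvS, hv.1, x, hx, h⟩)
      · exact absurd hxS (memB.1 hx).1
    · intro v hv hvS x hx hxS
      simp only [Finset.mem_union, not_or] at hv hx
      rcases hv with hv | hv | hv
      · exact hP.inside v hv hvS x hx.1 hxS
      · exact absurd (memC.1 hv).1 hvS
      · by_contra h
        exact hx.2.1 (hBC v hv x hxS h)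
    · intro v hv h
      exact Finset.mem_union_left _ (hP.full v hv h)
  · have h1 : Reach 84 G (P ∪ E ∩ (C ∪ B)) := hR.extend Finset.subset_union_left
      fun Z h1 h2 => hcut Z h1
        (h2.trans (Finset.union_subset_union_right Finset.inter_subset_right))
        (Or.inl (h2.trans (Finset.union_subset_union_right Finset.inter_subset_left)))
    exact h1.extend (Finset.union_subset_union_right Finset.inter_subset_right)
      fun Z h1 h2 => hcut Z (Finset.subset_union_left.trans h1) h2
        (Or.inr (Finset.subset_union_right.trans h1))

theorem CliquesAndIndep.reach (hG : Tame G) {S : Finset V} (hS : CliquesAndIndep G S) :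
    Reach 84 G Finset.univ := by
  have key : ∀ n (P : Finset V), (Pᶜ).card = n → ClosedIn G S P → Reach 84 G P →
      Reach 84 G Finset.univ := by
    intro n
    induction n using Nat.strong_induction_on with
    | _ n ih =>
      intro P hn hP hR
      by_cases h : ∃ s ∈ S, s ∉ P
      · obtain ⟨s, hs, hsP⟩ := h
        obtain ⟨Q, hPQ, hsQ, hQ, hRQ⟩ := hP.exists_reach hG hS hR hs hsP
        refine ih _ ?_ Q rfl hQ hRQ
        rw [← hn]
        refine Finset.card_lt_card (Finset.ssubset_iff_subset_ne.2
          ⟨Finset.compl_subset_compl.2 hPQ, fun h => hsP ?_⟩)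
        rw [compl_inj_iff] at h
        exact h ▸ hsQ
      · push Not at h
        have : P = Finset.univ := by
          refine Finset.eq_univ_of_forall fun v => ?_
          by_cases hv : v ∈ S
          · exact h v hv
          · by_contra hvP
            exact hvP (hP.full v hv fun x hx => hP.outside v hvP hv x (h x hx) hx)
        exact this ▸ hR
  -- The chain starts with the vertices complete to `S`: they belong to no component and share one
  -- neighbourhood, namely `S`.
  let F := Finset.univ.filter fun v => v ∉ S ∧ ∀ x ∈ S, G.Adj v x
  have memF : ∀ {v}, v ∈ F ↔ v ∉ S ∧ ∀ x ∈ S, G.Adj v x := by simp [F]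
  refine key _ F rfl ?_ ?_
  · exact ⟨fun x hx hxS => absurd hxS (memF.1 hx).1, fun v hv hvS x hx hxS =>
      absurd hxS (memF.1 hx).1, fun v hv _ x _ hxS => (memF.1 hv).2 x hxS,
      fun v hv h => memF.2 ⟨hv, h⟩⟩
  · refine Reach.empty.extend (Finset.empty_subset _) fun Z _ hZ => ?_
    refine Cut.of_colouring (E := ∅) (fun _ => ()) (by simp) fun x hx y hy _ _ _ w hw => ?_
    have hx' := memF.1 (hZ hx)
    have hy' := memF.1 (hZ hy)
    by_cases hwS : w ∈ S
    · exact iff_of_true (hx'.2 w hwS) (hy'.2 w hwS)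
    · exact iff_of_false (hS.indep x hx'.1 w hwS) (hS.indep y hy'.1 w hwS)

omit [Fintype V] in
theorem card_closed_nbrs_le {I : Finset V} (hI : G.IsIndepSet (I : Set V)) {v : V}
    (hv : (devs G False v I).card ≤ 1) : (I.filter fun i => i = v ∨ G.Adj v i).card ≤ 1 := by
  by_cases hvI : v ∈ I
  · refine Finset.card_le_one.2 fun i hi j hj => ?_
    rw [Finset.mem_filter] at hi hj
    rw [hi.2.resolve_right (indep_not_adj hI hvI hi.1),
      hj.2.resolve_right (indep_not_adj hI hvI hj.1)]
  · refine (Finset.card_le_card fun i hi => ?_).trans hv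
    rw [Finset.mem_filter] at hi
    rw [mem_devs, iff_false, not_not]
    exact ⟨hi.1, hi.2.resolve_left (by rintro rfl; exact hvI hi.1)⟩

omit [Fintype V] in
-- Three sparse vertices meet at most three of the five members of `I`, counting coincidence as well
-- as adjacency; the other two turn an induced `P₃` into `2P₁ + P₃`.
theorem adj_of_sparse (hG : HFree G) {I : Finset V} (hI : G.IsIndepSet (I : Set V))
    (hI5 : I.card = 5) {x y z : V} (hx : (devs G False x I).card ≤ 1)
    (hy : (devs G False y I).card ≤ 1) (hz : (devs G False z I).card ≤ 1) (hxy : G.Adj x y)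
    (hyz : G.Adj y z) (hxz : x ≠ z) : G.Adj x z := by
  by_contra hn
  have hx' := card_closed_nbrs_le hI hx
  have hy' := card_closed_nbrs_le hI hy
  have hz' := card_closed_nbrs_le hI hz
  obtain ⟨a, ha, b, hb, haS, hbS, hab⟩ := exists_two_avoid (X := I)
    (S := (I.filter fun i => i = x ∨ G.Adj x i) ∪ ((I.filter fun i => i = y ∨ G.Adj y i) ∪
      (I.filter fun i => i = z ∨ G.Adj z i))) (by
        refine Nat.lt_of_le_of_lt (Nat.succ_le_succ ((Finset.card_union_le _ _).trans
          (Nat.add_le_add_left (Finset.card_union_le _ _) _))) ?_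
        omega)
  simp only [Finset.mem_union, Finset.mem_filter, ha, hb, true_and, not_or] at haS hbS
  exact hG a b x y z hab (indep_not_adj hI ha hb) hxz hn hxy hyz
    (fun h => haS.1.2 h.symm) (fun h => haS.2.1.2 h.symm) (fun h => haS.2.2.2 h.symm)
    (fun h => hbS.1.2 h.symm) (fun h => hbS.2.1.2 h.symm) (fun h => hbS.2.2.2 h.symm)

omit [Fintype V] in
-- Two members `a`, `b` of `I` are adjacent to `v` but not to `x` or `y`. The path `a v b` with `x`
-- and `y` non-adjacent would be a `2P₁ + P₃`.
theorem adj_of_nonadj_dense (hG : HFree G) {I : Finset V} (hI : G.IsIndepSet (I : Set V))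
    (hI5 : I.card = 5) {v x y : V} (hx : (devs G False x I).card ≤ 1)
    (hy : (devs G False y I).card ≤ 1) (hv : (devs G True v I).card ≤ 1) (hvx : ¬ G.Adj v x)
    (hvy : ¬ G.Adj v y) (hxy : x ≠ y) : G.Adj x y := by
  by_contra hn
  have hx' := card_closed_nbrs_le hI hx
  have hy' := card_closed_nbrs_le hI hy
  obtain ⟨a, ha, b, hb, haS, hbS, hab⟩ := exists_two_avoid (X := I)
    (S := (I.filter fun i => i = x ∨ G.Adj x i) ∪ ((I.filter fun i => i = y ∨ G.Adj y i) ∪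
      devs G True v I)) (by
        refine Nat.lt_of_le_of_lt (Nat.succ_le_succ ((Finset.card_union_le _ _).trans
          (Nat.add_le_add_left (Finset.card_union_le _ _) _))) ?_
        omega)
  simp only [Finset.mem_union, Finset.mem_filter, mem_devs, iff_true, ha, hb, true_and, not_or,
    not_not] at haS hbS
  exact hG x y a v b hxy hn hab (indep_not_adj hI ha hb) haS.2.2.symm hbS.2.2 haS.1.2
    (fun h => hvx h.symm) hbS.1.2 haS.2.1.2 (fun h => hvy h.symm) hbS.2.1.2

/-- Each predicate fails for at most one of the three indices. -/
theorem exists_common {p q : Fin 3 → Prop} (hp : ∀ j k, j ≠ k → p j ∨ p k)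
    (hq : ∀ j k, j ≠ k → q j ∨ q k) : ∃ j, p j ∧ q j := by
  have p01 := hp 0 1 (by decide)
  have p02 := hp 0 2 (by decide)
  have p12 := hp 1 2 (by decide)
  have q01 := hq 0 1 (by decide)
  have q02 := hq 0 2 (by decide)
  have q12 := hq 1 2 (by decide)
  by_cases h0 : p 0 ∧ q 0
  · exact ⟨0, h0⟩
  by_cases h1 : p 1 ∧ q 1
  · exact ⟨1, h1⟩
  exact ⟨2, by tauto⟩

theorem reach_of_hasU (hG : Tame G) (hU : HasU G) : Reach 84 G Finset.univ := by
  obtain ⟨I, x, y, hI5, hI, hxy, hanti, hcross⟩ := hU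
  let S := Finset.univ.filter fun v => (devs G False v I).card ≤ 1
  have memS : ∀ {v}, v ∈ S ↔ (devs G False v I).card ≤ 1 := by simp [S]
  have hD : ∀ v, v ∉ S → (devs G True v I).card ≤ 1 := fun v hv =>
    (devs_card_of_indep hG.hfree hI v).resolve_left fun h => hv (memS.2 h)
  have hnon : ∀ v ∉ S, ∀ x ∈ S, ∀ y ∈ S, ¬ G.Adj v x → ¬ G.Adj v y → x ≠ y → G.Adj x y :=
    fun v hv x hx y hy => adj_of_nonadj_dense hG.hfree hI hI5 (memS.1 hx) (memS.1 hy) (hD v hv)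
  have hxS : ∀ j, x j ∈ S := fun j => by
    rw [memS]
    refine Nat.le_trans (Nat.le_of_eq (Finset.card_eq_zero.2 ?_)) zero_le_one
    ext i
    simp only [mem_devs, iff_false, not_not, Finset.notMem_empty, not_and]
    exact fun hi => (hanti j i hi).1
  have hyS : ∀ j, y j ∈ S := fun j => by
    rw [memS]
    refine Nat.le_trans (Nat.le_of_eq (Finset.card_eq_zero.2 ?_)) zero_le_one
    ext i
    simp only [mem_devs, iff_false, not_not, Finset.notMem_empty, not_and]
    exact fun hi => (hanti j i hi).2
  refine CliquesAndIndep.reach hG (S := S) ⟨?_, ?_, hnon⟩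
  · exact fun x hx y hy z hz => adj_of_sparse hG.hfree hI hI5 (memS.1 hx) (memS.1 hy) (memS.1 hz)
  intro v hv w hw hvw
  -- The non-neighbours of `u` in `S` form a clique, so they cannot meet two of the three edges.
  have hgood : ∀ u ∉ S, ∀ j k, j ≠ k →
      (G.Adj u (x j) ∧ G.Adj u (y j)) ∨ (G.Adj u (x k) ∧ G.Adj u (y k)) := by
    intro u hu j k hjk
    by_contra! h
    have hne : ∀ p q : V, p ∈ S → q ∈ S → (p = x j ∨ p = y j) → (q = x k ∨ q = y k) →
        ¬ G.Adj u p → ¬ G.Adj u q → False := by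
      intro p q hpS hqS hp hq hup huq
      have h1 := hcross j k hjk
      have h2 := hcross k j hjk.symm
      have hnadj : ¬ G.Adj p q := by
        rcases hp with rfl | rfl <;> rcases hq with rfl | rfl
        · exact h1.1
        · exact h1.2.1
        · exact fun h => h2.2.1 h.symm
        · exact h1.2.2
      refine hnadj (hnon u hu p hpS q hqS hup huq ?_)
      rintro rfl
      rcases hp with rfl | rfl <;> rcases hq with hq | hq
      · exact h2.2.1 (hq ▸ hxy j)
      · exact h1.1 ((hq ▸ (hxy k).symm : G.Adj (x j) (x k)))
      · exact h1.2.1 (((hq ▸ hxy k : G.Adj (y j) (y k)) |> h1.2.2).elim)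
      · exact h1.2.1 (hq ▸ hxy j)
    by_cases h1 : G.Adj u (x j)
    · by_cases h2 : G.Adj u (x k)
      · exact hne _ _ (hyS j) (hyS k) (Or.inr rfl) (Or.inr rfl) (h.1 h1) (h.2 h2)
      · exact hne _ _ (hyS j) (hxS k) (Or.inr rfl) (Or.inl rfl) (h.1 h1) h2
    · by_cases h2 : G.Adj u (x k)
      · exact hne _ _ (hxS j) (hyS k) (Or.inl rfl) (Or.inr rfl) h1 (h.2 h2)
      · exact hne _ _ (hxS j) (hxS k) (Or.inl rfl) (Or.inl rfl) h1 h2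
  -- Adjacent dense `v`, `w` would share an edge `x j`, `y j` and a neighbour `i ∈ I`, which gives
  -- the complement of `2P₁ + P₃`.
  obtain ⟨j, hvj, hwj⟩ := exists_common (hgood v hv) (hgood w hw)
  obtain ⟨i, hi, hiS⟩ : ∃ i ∈ I, i ∉ devs G True v I ∪ devs G True w I := by
    refine exists_mem_avoid (lt_of_le_of_lt (Finset.card_union_le _ _) ?_)
    have := hD v hv
    have := hD w hw
    omega
  simp only [Finset.mem_union, mem_devs, hi, iff_true, true_and, not_or, not_not] at hiS
  exact hG.cofree' hvw (hxy j)
    (by rintro h; exact (hanti j i hi).2 (h ▸ (hxy j).symm)) (hanti j i hi).1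
    (by rintro h; exact (hanti j i hi).1 (h ▸ hxy j)) (hanti j i hi).2
    hvj.1 hvj.2 hiS.1 hwj.1 hwj.2 hiS.2

end Split

/-! ### Covering by few cliques and independent sets -/

/-- `Q` is covered by at most `n` cliques and independent sets. -/
def Coverable {V : Type u} (n : ℕ) (G : SimpleGraph V) (Q : Finset V) : Prop :=
  ∃ F : Finset (Finset V), F.card ≤ n ∧
    (∀ X ∈ F, G.IsClique (X : Set V) ∨ G.IsIndepSet (X : Set V)) ∧ ∀ v ∈ Q, ∃ X ∈ F, v ∈ X

/-- `Q` has no induced `P₃`. -/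
def P3Free {V : Type u} (G : SimpleGraph V) (Q : Finset V) : Prop :=
  ∀ x ∈ Q, ∀ y ∈ Q, ∀ z ∈ Q, G.Adj x y → G.Adj y z → x ≠ z → G.Adj x z

/-- `Q` has no induced `P₁ + P₃`. -/
def P1P3Free {V : Type u} (G : SimpleGraph V) (Q : Finset V) : Prop :=
  ∀ a ∈ Q, ∀ x ∈ Q, ∀ y ∈ Q, ∀ z ∈ Q, G.Adj x y → G.Adj y z → x ≠ z → ¬ G.Adj x z →
    ¬ G.Adj a x → ¬ G.Adj a y → ¬ G.Adj a z → False

section Cover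

open Classical

variable {V : Type u} {G : SimpleGraph V} {n : ℕ} {Q : Finset V}

theorem Coverable.mono {m : ℕ} (h : Coverable n G Q) (hnm : n ≤ m) : Coverable m G Q := by
  obtain ⟨F, hF, h⟩ := h
  exact ⟨F, hF.trans hnm, h⟩

theorem Coverable.of_compl (h : Coverable n Gᶜ Q) : Coverable n G Q := by
  obtain ⟨F, hF, h1, h2⟩ := h
  refine ⟨F, hF, fun X hX => ?_, h2⟩
  have := h1 X hX
  rw [isClique_compl, isIndepSet_compl] at this
  exact this.symm

theorem Coverable.filter {m : ℕ} (p : V → Prop) [DecidablePred p] (h1 : Coverable n G (Q.filter p))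
    (h2 : Coverable m G (Q.filter fun v => ¬ p v)) : Coverable (n + m) G Q := by
  obtain ⟨F, hF, hF1, hF2⟩ := h1
  obtain ⟨F', hF', hF1', hF2'⟩ := h2
  refine ⟨F ∪ F', (Finset.card_union_le _ _).trans (Nat.add_le_add hF hF'), ?_, ?_⟩
  · intro X hX
    exact (Finset.mem_union.1 hX).elim (hF1 X) (hF1' X)
  · intro v hv
    by_cases hp : p v
    · obtain ⟨X, hX, hvX⟩ := hF2 v (Finset.mem_filter.2 ⟨hv, hp⟩)
      exact ⟨X, Finset.mem_union_left _ hX, hvX⟩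
    · obtain ⟨X, hX, hvX⟩ := hF2' v (Finset.mem_filter.2 ⟨hv, hp⟩)
      exact ⟨X, Finset.mem_union_right _ hX, hvX⟩

theorem Coverable.of_card (h : Q.card ≤ n) : Coverable n G Q := by
  refine ⟨Q.image fun v => {v}, Finset.card_image_le.trans h, fun X hX => ?_, fun v hv => ?_⟩
  · obtain ⟨v, -, rfl⟩ := Finset.mem_image.1 hX
    left
    simp
  · exact ⟨{v}, Finset.mem_image_of_mem _ hv, Finset.mem_singleton_self v⟩

/-- A `P₃`-free set is a disjoint union of cliques, and a maximum independent set `T` picks one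
vertex from each. If there are more than eight cliques, at most two have an edge, since three such
cliques and five further representatives contain `5P₁ + 3P₂`; `T` and these two then cover
everything. -/
theorem P3Free.coverable (hQ : P3Free G Q) (hU : ¬ HasU G) : Coverable 8 G Q := by
  obtain ⟨T, hT, hTmax⟩ := Finset.exists_max_image
    (Q.powerset.filter fun T : Finset V => G.IsIndepSet (T : Set V)) Finset.card
    ⟨∅, by simp [SimpleGraph.IsIndepSet]⟩
  rw [Finset.mem_filter, Finset.mem_powerset] at hT
  obtain ⟨hTQ, hT⟩ := hT
  have hdom : ∀ v ∈ Q, v ∉ T → ∃ t ∈ T, G.Adj t v := by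
    intro v hv hvT
    by_contra! h
    have hind : G.IsIndepSet ((insert v T : Finset V) : Set V) := by
      intro x hx y hy hxy
      rw [Finset.mem_coe, Finset.mem_insert] at hx hy
      rcases hx with rfl | hx <;> rcases hy with rfl | hy
      · exact absurd rfl hxy
      · exact fun h' => h y hy h'.symm
      · exact h x hx
      · exact hT hx hy hxy
    have := hTmax (insert v T) (by
      rw [Finset.mem_filter, Finset.mem_powerset]
      exact ⟨Finset.insert_subset hv hTQ, hind⟩)
    rw [Finset.card_insert_of_notMem hvT] at this
    omega
  let N : V → Finset V := fun t => Q.filter fun v => v = t ∨ G.Adj t v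
  have hN : ∀ t ∈ T, G.IsClique (N t : Set V) := by
    intro t ht x hx y hy hxy
    simp only [N, Finset.mem_coe, Finset.mem_filter] at hx hy
    rcases hx.2 with rfl | h <;> rcases hy.2 with rfl | h'
    · exact absurd rfl hxy
    · exact h'
    · exact h.symm
    · exact hQ x hx.1 t (hTQ ht) y hy.1 h.symm h' hxy
  by_cases hcard : T.card ≤ 8
  · refine ⟨T.image N, Finset.card_image_le.trans hcard, fun X hX => ?_, fun v hv => ?_⟩
    · obtain ⟨t, ht, rfl⟩ := Finset.mem_image.1 hX
      exact Or.inl (hN t ht)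
    · by_cases hvT : v ∈ T
      · exact ⟨N v, Finset.mem_image_of_mem _ hvT, by simp [N, hv]⟩
      · obtain ⟨t, ht, htv⟩ := hdom v hv hvT
        exact ⟨N t, Finset.mem_image_of_mem _ ht, by simp [N, hv, htv]⟩
  let W := T.filter fun t => ∃ y ∈ Q, G.Adj t y
  have hW : W.card ≤ 2 := by
    by_contra! hc
    obtain ⟨S, hS, hS3⟩ := Finset.exists_subset_card_eq (Nat.succ_le_of_lt hc)
    let f := S.equivFinOfCardEq hS3
    let x : Fin 3 → V := fun j => (f.symm j : V)
    have hxS : ∀ j, x j ∈ S := fun j => (f.symm j).2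
    have hx : ∀ j, x j ∈ T ∧ ∃ y ∈ Q, G.Adj (x j) y := fun j => Finset.mem_filter.1 (hS (hxS j))
    have hxinj : ∀ j k, j ≠ k → x j ≠ x k := fun j k hjk h =>
      hjk (f.symm.injective (Subtype.ext h))
    choose y hyQ hxy using fun j => (hx j).2
    have hy : ∀ j, ∀ t ∈ T, t ≠ x j → ¬ G.Adj (y j) t := fun j t ht htx h =>
      indep_not_adj hT (hx j).1 ht
        (hQ _ (hTQ (hx j).1) _ (hyQ j) _ (hTQ ht) (hxy j) h (Ne.symm htx))
    have hTS : 5 ≤ (T \ S).card := by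
      have := Finset.le_card_sdiff S T
      omega
    obtain ⟨I, hI, hI5⟩ := Finset.exists_subset_card_eq hTS
    have hIT : ∀ i ∈ I, i ∈ T ∧ i ∉ S := fun i hi => Finset.mem_sdiff.1 (hI hi)
    refine hU ⟨I, x, y, hI5, ?_, hxy, ?_, ?_⟩
    · intro i hi j hj _
      exact indep_not_adj hT (hIT i hi).1 (hIT j hj).1
    · intro j i hi
      exact ⟨indep_not_adj hT (hx j).1 (hIT i hi).1,
        hy j i (hIT i hi).1 fun h => (hIT i hi).2 (h ▸ hxS j)⟩
    · intro j k hjk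
      have h1 : ¬ G.Adj (x j) (y k) := fun h => hy k _ (hx j).1 (hxinj j k hjk) h.symm
      refine ⟨indep_not_adj hT (hx j).1 (hx k).1, h1, fun h => h1 ?_⟩
      refine hQ _ (hTQ (hx j).1) _ (hyQ j) _ (hyQ k) (hxy j) h fun h' => ?_
      exact indep_not_adj hT (hx k).1 (hx j).1 (h' ▸ hxy k)
  refine ⟨insert T (W.image N), ?_, fun X hX => ?_, fun v hv => ?_⟩
  · have := Finset.card_insert_le T (W.image N)
    have := Finset.card_image_le (s := W) (f := N)
    omega
  · rcases Finset.mem_insert.1 hX with rfl | hX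
    · exact Or.inr hT
    · obtain ⟨t, ht, rfl⟩ := Finset.mem_image.1 hX
      exact Or.inl (hN t (Finset.mem_filter.1 ht).1)
  · by_cases hvT : v ∈ T
    · exact ⟨T, Finset.mem_insert_self _ _, hvT⟩
    · obtain ⟨t, ht, htv⟩ := hdom v hv hvT
      refine ⟨N t, Finset.mem_insert_of_mem (Finset.mem_image_of_mem _ ?_), by simp [N, hv, htv]⟩
      exact Finset.mem_filter.2 ⟨ht, v, hv, htv⟩

/-- Ramsey's theorem. -/
theorem exists_clique_or_indep (G : SimpleGraph V) (s t : ℕ) (Q : Finset V)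
    (hQ : 2 ^ (s + t) ≤ Q.card) :
    (∃ K ⊆ Q, K.card = s ∧ G.IsClique (K : Set V)) ∨
      ∃ I ⊆ Q, I.card = t ∧ G.IsIndepSet (I : Set V) := by
  induction hm : s + t using Nat.strong_induction_on generalizing s t Q with
  | _ m ih =>
  subst hm
  rcases s with _ | s
  · exact Or.inl ⟨∅, Finset.empty_subset _, rfl, by simp⟩
  rcases t with _ | t
  · exact Or.inr ⟨∅, Finset.empty_subset _, rfl, by simp [SimpleGraph.IsIndepSet]⟩
  obtain ⟨v, hv⟩ : Q.Nonempty := Finset.card_pos.1 (lt_of_lt_of_le (by positivity) hQ)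
  have hsplit := Finset.card_filter_add_card_filter_not (s := Q.erase v) (G.Adj v)
  rw [Finset.card_erase_of_mem hv] at hsplit
  have hpow : 2 ^ (s + 1 + (t + 1)) = 2 * 2 ^ (s + t + 1) := by ring
  have hsub : ∀ (p : V → Prop) [DecidablePred p], (Q.erase v).filter p ⊆ Q := fun p _ =>
    (Finset.filter_subset _ _).trans (Finset.erase_subset _ _)
  rcases Nat.lt_or_ge ((Q.erase v).filter (G.Adj v)).card (2 ^ (s + t + 1)) with h | h
  · have h' : 2 ^ (s + 1 + t) ≤ ((Q.erase v).filter fun w => ¬ G.Adj v w).card := by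
      rw [show s + 1 + t = s + t + 1 by ring]
      omega
    rcases ih (s + 1 + t) (by omega) (s + 1) t _ h' rfl with ⟨K, hK, hKs⟩ | ⟨I, hI, hIt, hI'⟩
    · exact Or.inl ⟨K, hK.trans (hsub _), hKs⟩
    · have hIv : ∀ w ∈ I, w ≠ v ∧ ¬ G.Adj v w := fun w hw => by
        have := hI hw
        rw [Finset.mem_filter, Finset.mem_erase] at this
        exact ⟨this.1.1, this.2⟩
      refine Or.inr ⟨insert v I, Finset.insert_subset hv (hI.trans (hsub _)), ?_, ?_⟩
      · rw [Finset.card_insert_of_notMem fun h => (hIv v h).1 rfl, hIt]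
      · intro x hx y hy hxy
        rw [Finset.mem_coe, Finset.mem_insert] at hx hy
        rcases hx with rfl | hx <;> rcases hy with rfl | hy
        · exact absurd rfl hxy
        · exact (hIv y hy).2
        · exact fun h => (hIv x hx).2 h.symm
        · exact hI' hx hy hxy
  · have h' : 2 ^ (s + (t + 1)) ≤ ((Q.erase v).filter (G.Adj v)).card := h
    rcases ih (s + (t + 1)) (by omega) s (t + 1) _ h' rfl with ⟨K, hK, hKs, hK'⟩ | ⟨I, hI, hIt⟩
    · have hKv : ∀ w ∈ K, w ≠ v ∧ G.Adj v w := fun w hw => by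
        have := hK hw
        rw [Finset.mem_filter, Finset.mem_erase] at this
        exact ⟨this.1.1, this.2⟩
      refine Or.inl ⟨insert v K, Finset.insert_subset hv (hK.trans (hsub _)), ?_, ?_⟩
      · rw [Finset.card_insert_of_notMem fun h => (hKv v h).1 rfl, hKs]
      · intro x hx y hy hxy
        rw [Finset.mem_coe, Finset.mem_insert] at hx hy
        rcases hx with rfl | hx <;> rcases hy with rfl | hy
        · exact absurd rfl hxy
        · exact (hKv y hy).2
        · exact (hKv x hx).2.symm
        · exact hK' hx hy hxy
    · exact Or.inr ⟨I, hI.trans (hsub _), hIt⟩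

theorem P3Free.of_sparse (hG : HFree G) {I : Finset V} (hI : G.IsIndepSet (I : Set V))
    (hI5 : I.card = 5) : P3Free G (Q.filter fun v => (devs G False v I).card ≤ 1) :=
  fun _ hx _ hy _ hz => adj_of_sparse hG hI hI5 (Finset.mem_filter.1 hx).2
    (Finset.mem_filter.1 hy).2 (Finset.mem_filter.1 hz).2

theorem adj_of_notMem_devs {v i : V} {I : Finset V} (hi : i ∈ I) (h : i ∉ devs G True v I) :
    G.Adj v i := by
  simpa [mem_devs, hi] using h

/-- A paw-free set containing five independent vertices. -/
theorem coverable_of_pawFree_of_indep (hG : Tame G) (hU : ¬ HasU G) (hU' : ¬ HasU Gᶜ)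
    (hQ : P1P3Free Gᶜ Q) {I : Finset V} (hIQ : I ⊆ Q) (hI : G.IsIndepSet (I : Set V))
    (hI5 : I.card = 5) : Coverable 16 G Q := by
  refine Coverable.filter (n := 8) (m := 8) (fun v => (devs G False v I).card ≤ 1)
    ((P3Free.of_sparse hG.hfree hI hI5).coverable hU) (Coverable.of_compl ?_)
  refine P3Free.coverable ?_ hU'
  have hdense : ∀ v ∈ Q.filter (fun v => ¬ (devs G False v I).card ≤ 1),
      v ∈ Q ∧ (devs G True v I).card ≤ 1 := fun v hv =>
    ⟨(Finset.mem_filter.1 hv).1,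
      (devs_card_of_indep hG.hfree hI v).resolve_left (Finset.mem_filter.1 hv).2⟩
  intro x hx y hy z hz hxy hyz hxz
  by_contra hn
  replace hx := hdense x hx
  replace hy := hdense y hy
  replace hz := hdense z hz
  -- A common neighbour of three dense vertices is isolated from them in `Gᶜ`, so an induced `P₃`
  -- there would extend to `P₁ + P₃`.
  obtain ⟨i, hi, hiS⟩ : ∃ i ∈ I, i ∉ devs G True x I ∪ (devs G True y I ∪ devs G True z I) := by
    refine exists_mem_avoid (lt_of_le_of_lt ((Finset.card_union_le _ _).trans
      (Nat.add_le_add_left (Finset.card_union_le _ _) _)) ?_)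
    omega
  simp only [Finset.mem_union, not_or] at hiS
  have hcomp : ∀ v, i ∉ devs G True v I → ¬ Gᶜ.Adj i v := fun v h h' =>
    ((SimpleGraph.compl_adj _ _ _).1 h').2 (adj_of_notMem_devs hi h).symm
  exact hQ i (hIQ hi) x hx.1 y hy.1 z hz.1 hxy hyz hxz hn (hcomp x hiS.1) (hcomp y hiS.2.1)
    (hcomp z hiS.2.2)

theorem coverable_of_p1p3Free_of_clique (hG : Tame G) (hU : ¬ HasU G) (hU' : ¬ HasU Gᶜ)
    (hQ : P1P3Free G Q) {K : Finset V} (hKQ : K ⊆ Q) (hK : G.IsClique (K : Set V))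
    (hK5 : K.card = 5) : Coverable 16 G Q :=
  Coverable.of_compl (coverable_of_pawFree_of_indep hG.compl hU' (by rwa [compl_compl])
    (by rwa [compl_compl]) hKQ ((isIndepSet_compl G).2 hK) hK5)

/-- The vertices with at most one non-neighbour in an independent set of size five are paw-free. -/
theorem pawFree_of_dense (hG : Tame G) {I : Finset V} (hI : G.IsIndepSet (I : Set V))
    (hI5 : I.card = 5) : P1P3Free Gᶜ (Q.filter fun v => ¬ (devs G False v I).card ≤ 1) := by
  have hdense : ∀ v ∈ Q.filter (fun v => ¬ (devs G False v I).card ≤ 1),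
      (devs G True v I).card ≤ 1 := fun v hv =>
    (devs_card_of_indep hG.hfree hI v).resolve_left (Finset.mem_filter.1 hv).2
  intro a ha x hx y hy z hz hxy hyz hxz hn hax hay haz
  replace ha := hdense a ha
  replace hx := hdense x hx
  replace hy := hdense y hy
  replace hz := hdense z hz
  -- Four dense vertices miss at most four of the five members of `I`. In `Gᶜ`, the remaining one
  -- and `a` form the `2P₁`.
  obtain ⟨i, hi, hiS⟩ : ∃ i ∈ I, i ∉ (devs G True a I ∪ devs G True x I) ∪
      (devs G True y I ∪ devs G True z I) := by
    refine exists_mem_avoid (lt_of_le_of_lt ((Finset.card_union_le _ _).trans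
      (Nat.add_le_add (Finset.card_union_le _ _) (Finset.card_union_le _ _))) ?_)
    omega
  simp only [Finset.mem_union, not_or] at hiS
  have hcomp : ∀ v, i ∉ devs G True v I → ¬ Gᶜ.Adj i v := fun v h h' =>
    ((SimpleGraph.compl_adj _ _ _).1 h').2 (adj_of_notMem_devs hi h).symm
  exact hG.cofree a i x y z (adj_of_notMem_devs hi hiS.1.1).ne
    (fun h => hcomp a hiS.1.1 h.symm) hxz hn hxy hyz hax hay haz
    (hcomp x hiS.1.2) (hcomp y hiS.2.1) (hcomp z hiS.2.2)

/-- A clique of size five settles the matter by complementation. With an independent set of size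
five, the sparse part is `P₃`-free, and the dense part is both paw-free and `(P₁ + P₃)`-free, so
there a clique or an independent set of size five suffices. By Ramsey, sets without either have
fewer than `2 ^ 10` vertices, and `1032 = 8 + 1024`. -/
theorem coverable_of_p1p3Free (hG : Tame G) (hU : ¬ HasU G) (hU' : ¬ HasU Gᶜ)
    (hQ : P1P3Free G Q) : Coverable 1032 G Q := by
  rcases Nat.lt_or_ge Q.card (2 ^ (5 + 5)) with h | h
  · exact Coverable.of_card (by omega)
  rcases exists_clique_or_indep G 5 5 Q h with ⟨K, hKQ, hK5, hK⟩ | ⟨I, -, hI5, hI⟩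
  · exact (coverable_of_p1p3Free_of_clique hG hU hU' hQ hKQ hK hK5).mono (by omega)
  refine Coverable.filter (n := 8) (m := 1024) (fun v => (devs G False v I).card ≤ 1)
    ((P3Free.of_sparse hG.hfree hI hI5).coverable hU) ?_
  have hpaw := pawFree_of_dense (Q := Q) hG hI hI5
  have hQ' : P1P3Free G (Q.filter fun v => ¬ (devs G False v I).card ≤ 1) :=
    fun a ha x hx y hy z hz => hQ a (Finset.mem_filter.1 ha).1 x (Finset.mem_filter.1 hx).1
      y (Finset.mem_filter.1 hy).1 z (Finset.mem_filter.1 hz).1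
  generalize Q.filter (fun v => ¬ (devs G False v I).card ≤ 1) = R at hpaw hQ'
  rcases Nat.lt_or_ge R.card (2 ^ (5 + 5)) with h | h
  · exact Coverable.of_card (by omega)
  rcases exists_clique_or_indep G 5 5 R h with ⟨K, hKR, hK5, hK⟩ | ⟨J, hJR, hJ5, hJ⟩
  · exact (coverable_of_p1p3Free_of_clique hG hU hU' hQ' hKR hK hK5).mono (by omega)
  · exact (coverable_of_pawFree_of_indep hG hU hU' hpaw hJR hJ hJ5).mono (by omega)

theorem coverable_of_indep (hG : Tame G) (hU : ¬ HasU G) (hU' : ¬ HasU Gᶜ) {I : Finset V}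
    (hI : G.IsIndepSet (I : Set V)) (hI5 : I.card = 5) : Coverable 1040 G Q :=
  Coverable.filter (n := 8) (m := 1032) (fun v => (devs G False v I).card ≤ 1)
    ((P3Free.of_sparse hG.hfree hI hI5).coverable hU)
    (Coverable.of_compl (coverable_of_p1p3Free hG.compl hU' (by rwa [compl_compl])
      (pawFree_of_dense hG hI hI5)))

theorem Tame.coverable (hG : Tame G) (hU : ¬ HasU G) (hU' : ¬ HasU Gᶜ) (Q : Finset V) :
    Coverable 1040 G Q := by
  rcases Nat.lt_or_ge Q.card (2 ^ (5 + 5)) with h | h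
  · exact Coverable.of_card (by omega)
  rcases exists_clique_or_indep G 5 5 Q h with ⟨K, -, hK5, hK⟩ | ⟨I, -, hI5, hI⟩
  · exact Coverable.of_compl (coverable_of_indep hG.compl hU' (by rwa [compl_compl])
      ((isIndepSet_compl G).2 hK) hK5)
  · exact coverable_of_indep hG hU hU' hI hI5

end Cover

/-! ### Layers and the deviations between them -/

/-- Disjoint cliques and independent sets `X i`; the adjacency between any two large ones is
controlled in the sense of `PairOK`. -/
structure Layered {V : Type u} (G : SimpleGraph V) {ι : Type*} (X : ι → Finset V)
    (E : Sym2 ι → Finset V) (b : Sym2 ι → Prop) : Prop where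
  disj : ∀ i j, i ≠ j → Disjoint (X i) (X j)
  hom : ∀ i, G.IsClique (X i : Set V) ∨ G.IsIndepSet (X i : Set V)
  card_le : ∀ p, (E p).card ≤ 6
  pair : ∀ i j, i ≠ j → 20 ≤ (X i).card → 20 ≤ (X j).card →
    PairOK G (X i) (X j) (E s(i, j)) (b s(i, j))

section Layers

open Classical

variable {V : Type u} {G : SimpleGraph V}

theorem not_clique_of_indep {X : Finset V} (hX : 20 ≤ X.card) (h : G.IsIndepSet (X : Set V)) :
    ¬ G.IsClique (X : Set V) := by
  intro h'
  obtain ⟨x, hx, y, hy, hxy⟩ := Finset.one_lt_card.1 (show 1 < X.card by omega)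
  exact h hx hy hxy (h' hx hy hxy)

theorem Layered.compl {ι : Type*} {X : ι → Finset V} {E : Sym2 ι → Finset V} {b : Sym2 ι → Prop}
    (h : Layered G X E b) : Layered Gᶜ X E fun p => ¬ b p where
  disj := h.disj
  hom i := by rw [isClique_compl, isIndepSet_compl]; exact (h.hom i).symm
  card_le := h.card_le
  pair i j hij hi hj := PairOK.of_compl (h.disj i j hij) (by simpa using h.pair i j hij hi hj)

theorem adj_of_notMem_devs_of {b : Prop} (hb : b) {x y : V} {Y : Finset V} (hy : y ∈ Y)
    (h : y ∉ devs G b x Y) : G.Adj x y := by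
  simpa [mem_devs, hy, hb] using h

theorem not_adj_of_notMem_devs_of {b : Prop} (hb : ¬ b) {x y : V} {Y : Finset V} (hy : y ∈ Y)
    (h : y ∉ devs G b x Y) : ¬ G.Adj x y := by
  simpa [mem_devs, hy, hb] using h

variable {ι : Type*} {X : ι → Finset V} {E : Sym2 ι → Finset V} {b : Sym2 ι → Prop}

/-- The deviation `x y` forces `X j` to be independent. If `X j` and `X k` were not joined, then `y`
and `z` would be non-adjacent, and `x` with two of its neighbours in `X j` that are not adjacent to
`z` would form a `P₃` isolated from `y` and `z`. -/
theorem Layered.joined_of_two_devs (hG : Tame G) (h : Layered G X E b) {i j k : ι}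
    (hij : i ≠ j) (hjk : j ≠ k) (hi : 20 ≤ (X i).card) (hj : 20 ≤ (X j).card)
    (hk : 20 ≤ (X k).card) {x y z : V} (hx : x ∈ X i) (hy : y ∈ X j) (hz : z ∈ X k)
    (hxE : ∀ p, x ∉ E p) (hyE : ∀ p, y ∉ E p) (hzE : ∀ p, z ∉ E p)
    (hbij : b s(i, j)) (hxy : ¬ G.Adj x y) (hxz : ¬ G.Adj x z) : b s(j, k) := by
  by_contra hb
  have hXj : G.IsIndepSet (X j : Set V) := by
    have := (h.pair i j hij hi hj).dev x hx (hxE _) y hy (hyE _) (by tauto)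
    tauto
  have hyz : ¬ G.Adj y z := by
    intro hyz
    have := (h.pair j k hjk hj hk).dev y hy (hyE _) z hz (hzE _) (by tauto)
    have := not_clique_of_indep hj hXj
    tauto
  have h1 := (h.pair i j hij hi hj).left x hx (hxE _)
  have h2 := (h.pair j k hjk hj hk).right z hz (hzE _)
  obtain ⟨p, hp, q, hq, hpS, hqS, hpq⟩ := exists_two_avoid (X := X j)
    (S := devs G (b s(i, j)) x (X j) ∪ devs G (b s(j, k)) z (X j))
    (lt_of_le_of_lt (Nat.succ_le_succ (Finset.card_union_le _ _)) (by omega))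
  rw [Finset.mem_union, not_or] at hpS hqS
  have hnz : ∀ w ∈ X j, w ∉ devs G (b s(j, k)) z (X j) → ¬ G.Adj z w := fun w hw hwS =>
    not_adj_of_notMem_devs_of hb hw hwS
  exact hG.hfree y z p x q (by rintro rfl; exact Finset.disjoint_left.1 (h.disj j k hjk) hy hz)
    hyz hpq (indep_not_adj hXj hp hq) (adj_of_notMem_devs_of hbij hp hpS.1).symm
    (adj_of_notMem_devs_of hbij hq hqS.1) (indep_not_adj hXj hy hp) (fun h => hxy h.symm)
    (indep_not_adj hXj hy hq) (hnz p hp hpS.2) (fun h => hxz h.symm) (hnz q hq hqS.2)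

/-- If `x` and `y` are not adjacent, then `X i` is independent. Choosing `x' ∈ X i` adjacent to `y`,
and adjacent `z ∈ X k`, `w ∈ X l` that are both complete to `x`, `x'`, `y`, yields the complement of
`2P₁ + P₃`. -/
theorem Layered.adj_of_four_joined (hG : Tame G) (h : Layered G X E b) {i j k l : ι}
    (hij : i ≠ j) (hik : i ≠ k) (hil : i ≠ l) (hjk : j ≠ k) (hjl : j ≠ l) (hkl : k ≠ l)
    (hi : 20 ≤ (X i).card) (hj : 20 ≤ (X j).card) (hk : 20 ≤ (X k).card) (hl : 20 ≤ (X l).card)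
    {x y : V} (hx : x ∈ X i) (hy : y ∈ X j) (hxE : ∀ p, x ∉ E p) (hyE : ∀ p, y ∉ E p)
    (hbij : b s(i, j)) (hbik : b s(i, k)) (hbil : b s(i, l)) (hbjk : b s(j, k)) (hbjl : b s(j, l))
    (hbkl : b s(k, l)) : G.Adj x y := by
  by_contra hxy
  have hXi : G.IsIndepSet (X i : Set V) := by
    have := (h.pair i j hij hi hj).dev x hx (hxE _) y hy (hyE _) (by tauto)
    tauto
  have c1 := h.card_le s(i, k)
  have c2 := h.card_le s(i, l)
  have c3 := h.card_le s(k, l)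
  have d1 := (h.pair i j hij hi hj).right y hy (hyE _)
  obtain ⟨x', hx', hx'S⟩ : ∃ x' ∈ X i, x' ∉ devs G (b s(i, j)) y (X i) ∪ (E s(i, k) ∪ E s(i, l)) :=
    exists_mem_avoid (lt_of_le_of_lt ((Finset.card_union_le _ _).trans
      (Nat.add_le_add_left (Finset.card_union_le _ _) _)) (by omega))
  simp only [Finset.mem_union, not_or] at hx'S
  have hyx' : G.Adj y x' := adj_of_notMem_devs_of hbij hx' hx'S.1
  have d2 := (h.pair i k hik hi hk).left x hx (hxE _)
  have d3 := (h.pair i k hik hi hk).left x' hx' hx'S.2.1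
  have d4 := (h.pair j k hjk hj hk).left y hy (hyE _)
  obtain ⟨z, hz, hzS⟩ : ∃ z ∈ X k, z ∉ (devs G (b s(i, k)) x (X k) ∪ devs G (b s(i, k)) x' (X k)) ∪
      (devs G (b s(j, k)) y (X k) ∪ E s(k, l)) :=
    exists_mem_avoid (lt_of_le_of_lt ((Finset.card_union_le _ _).trans
      (Nat.add_le_add (Finset.card_union_le _ _) (Finset.card_union_le _ _))) (by omega))
  simp only [Finset.mem_union, not_or] at hzS
  have d5 := (h.pair i l hil hi hl).left x hx (hxE _)
  have d6 := (h.pair i l hil hi hl).left x' hx' hx'S.2.2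
  have d7 := (h.pair j l hjl hj hl).left y hy (hyE _)
  have d8 := (h.pair k l hkl hk hl).left z hz hzS.2.2
  obtain ⟨w, hw, hwS⟩ : ∃ w ∈ X l, w ∉ (devs G (b s(i, l)) x (X l) ∪ devs G (b s(i, l)) x' (X l)) ∪
      (devs G (b s(j, l)) y (X l) ∪ devs G (b s(k, l)) z (X l)) :=
    exists_mem_avoid (lt_of_le_of_lt ((Finset.card_union_le _ _).trans
      (Nat.add_le_add (Finset.card_union_le _ _) (Finset.card_union_le _ _))) (by omega))
  simp only [Finset.mem_union, not_or] at hwS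
  exact hG.cofree' (adj_of_notMem_devs_of hbkl hw hwS.2.2) hyx'
    (by rintro rfl; exact Finset.disjoint_left.1 (h.disj i j hij) hx hy) (fun h => hxy h.symm)
    (by rintro rfl; exact hxy hyx'.symm) (indep_not_adj hXi hx' hx)
    (adj_of_notMem_devs_of hbjk hz hzS.2.1).symm (adj_of_notMem_devs_of hbik hz hzS.1.2).symm
    (adj_of_notMem_devs_of hbik hz hzS.1.1).symm
    (adj_of_notMem_devs_of hbjl hw hwS.2.1).symm (adj_of_notMem_devs_of hbil hw hwS.1.2).symm
    (adj_of_notMem_devs_of hbil hw hwS.1.1).symm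

/-- An exceptional adjacency between the layers, away from all exceptional vertices. -/
def Dev {V : Type u} (G : SimpleGraph V) {ι : Type*} (b : Sym2 ι → Prop) (B : Finset V)
    (c : V → ι) (x y : V) : Prop :=
  x ∉ B ∧ y ∉ B ∧ c x ≠ c y ∧ ¬ (G.Adj x y ↔ b s(c x, c y))

theorem Dev.symm {B : Finset V} {c : V → ι} {x y : V} (h : Dev G b B c x y) :
    Dev G b B c y x :=
  ⟨h.2.1, h.1, h.2.2.1.symm, by rw [G.adj_comm, Sym2.eq_swap]; exact h.2.2.2⟩

theorem Dev.compl {B : Finset V} {c : V → ι} {x y : V} (h : Dev G b B c x y) :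
    Dev Gᶜ (fun p => ¬ b p) B c x y := by
  refine ⟨h.1, h.2.1, h.2.2.1, ?_⟩
  have h1 := h.2.2.2
  have h2 : x ≠ y := by rintro rfl; exact h.2.2.1 rfl
  rw [SimpleGraph.compl_adj]
  tauto

/-- Deviations at an independent layer are missing edges. By `joined_of_two_devs` the three target
layers are pairwise joined, so with the layer of `x` they are four joined layers, among which no
edge is missing. -/
theorem Layered.not_three_devs_of_indep (hG : Tame G) (h : Layered G X E b) {B : Finset V}
    {c : V → ι} (hc : ∀ v, v ∈ X (c v)) (hBE : ∀ v ∉ B, ∀ p, v ∉ E p)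
    (hB : ∀ v ∉ B, 20 ≤ (X (c v)).card) {x : V} (hX : G.IsIndepSet (X (c x) : Set V)) {y : Fin 3 → V}
    (hd : ∀ j, Dev G b B c x (y j)) (hy : ∀ j k, j ≠ k → c (y j) ≠ c (y k)) : False := by
  have hxE := hBE x (hd 0).1
  have hxB := hB x (hd 0).1
  have hyE := fun j => hBE (y j) (hd j).2.1
  have hyB := fun j => hB (y j) (hd j).2.1
  have hb : ∀ j, b s(c x, c (y j)) := by
    intro j
    have h1 := (h.pair _ _ (hd j).2.2.1 hxB (hyB j)).dev x (hc x) (hxE _) (y j) (hc _) (hyE j _)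
      (hd j).2.2.2
    have := not_clique_of_indep hxB hX
    tauto
  have hn : ∀ j, ¬ G.Adj x (y j) := by
    intro j
    have h1 := (hd j).2.2.2
    have h2 := hb j
    tauto
  have hb' : ∀ j k, j ≠ k → b s(c (y j), c (y k)) := fun j k hjk =>
    h.joined_of_two_devs hG (hd j).2.2.1 (hy j k hjk) hxB (hyB j) (hyB k)
      (hc x) (hc _) (hc _) hxE (hyE j) (hyE k) (hb j) (hn j) (hn k)
  exact hn 0 (h.adj_of_four_joined hG (hd 0).2.2.1 (hd 1).2.2.1 (hd 2).2.2.1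
    (hy 0 1 (by decide)) (hy 0 2 (by decide)) (hy 1 2 (by decide)) hxB (hyB 0) (hyB 1) (hyB 2)
    (hc x) (hc _) hxE (hyE 0) (hb 0) (hb 1) (hb 2) (hb' 0 1 (by decide)) (hb' 0 2 (by decide))
    (hb' 1 2 (by decide)))

/-- Deviations between two layers form a matching, so those at `x` lead to different layers. If the
layer of `x` is a clique, the complement is used. -/
theorem Layered.card_devs_le [Fintype V] (hG : Tame G) (h : Layered G X E b) {B : Finset V}
    {c : V → ι} (hc : ∀ v, v ∈ X (c v)) (hBE : ∀ v ∉ B, ∀ p, v ∉ E p)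
    (hB : ∀ v ∉ B, 20 ≤ (X (c v)).card) (x : V) :
    (Finset.univ.filter (Dev G b B c x)).card ≤ 2 := by
  by_contra! hcard
  obtain ⟨S, hS, hS3⟩ := Finset.exists_subset_card_eq (Nat.succ_le_of_lt hcard)
  let f := S.equivFinOfCardEq hS3
  let y : Fin 3 → V := fun j => (f.symm j : V)
  have hd : ∀ j, Dev G b B c x (y j) := fun j => (Finset.mem_filter.1 (hS (f.symm j).2)).2
  have hyinj : ∀ j k, j ≠ k → y j ≠ y k := fun j k hjk h =>
    hjk (f.symm.injective (Subtype.ext h))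
  have hxE := hBE x (hd 0).1
  have hxB := hB x (hd 0).1
  have hy : ∀ j k, j ≠ k → c (y j) ≠ c (y k) := by
    intro j k hjk heq
    have h1 := (h.pair _ _ (hd j).2.2.1 hxB (hB _ (hd j).2.1)).left x (hc x) (hxE _)
    refine (hd k).2.2.2 (heq ▸ ?_)
    exact adj_iff_of_devs h1 (hc (y j)) (hd j).2.2.2 (heq ▸ hc (y k)) (hyinj k j hjk.symm)
  rcases h.hom (c x) with hX | hX
  · exact h.compl.not_three_devs_of_indep hG.compl hc hBE hB ((isIndepSet_compl G).2 hX)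
      (fun j => (hd j).compl) hy
  · exact h.not_three_devs_of_indep hG hc hBE hB hX hd hy

/-- If a symmetric relation of maximum degree two has at most two pairs leaving `P`, then `P` can
be enlarged by one vertex so that this remains true. -/
theorem exists_insert_crossing_le [Fintype V] {r : V → V → Prop} (hr : ∀ x y, r x y → r y x)
    (hdeg : ∀ x, (Finset.univ.filter (r x)).card ≤ 2) {P : Finset V} (hP : P ≠ Finset.univ)
    (hcr : (Finset.univ.filter fun p : V × V => p.1 ∈ P ∧ p.2 ∉ P ∧ r p.1 p.2).card ≤ 2) :
    ∃ v ∉ P, (Finset.univ.filter fun p : V × V =>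
      p.1 ∈ insert v P ∧ p.2 ∉ insert v P ∧ r p.1 p.2).card ≤ 2 := by
  let cr : Finset V → Finset (V × V) := fun P =>
    Finset.univ.filter fun p : V × V => p.1 ∈ P ∧ p.2 ∉ P ∧ r p.1 p.2
  have memcr : ∀ {P p}, p ∈ cr P ↔ p.1 ∈ P ∧ p.2 ∉ P ∧ r p.1 p.2 := by simp [cr]
  change (cr P).card ≤ 2 at hcr
  change ∃ v ∉ P, (cr (insert v P)).card ≤ 2
  rcases Finset.eq_empty_or_nonempty (cr P) with hemp | ⟨⟨u, v⟩, huv⟩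
  · obtain ⟨v, hv⟩ : ∃ v, v ∉ P := by
      by_contra! h
      exact hP (Finset.eq_univ_of_forall h)
    refine ⟨v, hv, le_trans (Finset.card_le_card (t := (Finset.univ.filter (r v)).image (v, ·))
      fun p hp => ?_) (Finset.card_image_le.trans (hdeg v))⟩
    obtain ⟨h1, h2, h3⟩ := memcr.1 hp
    rw [Finset.mem_insert] at h1
    rw [Finset.mem_insert, not_or] at h2
    rcases h1 with h1 | h1
    · exact Finset.mem_image.2 ⟨p.2, by simpa [h1] using h3, by rw [← h1]⟩
    · exact absurd (memcr.2 ⟨h1, h2.2, h3⟩) (by rw [hemp]; exact Finset.notMem_empty p)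
  -- The outer end `v` of a crossing pair is added: this pair is lost and, as `u` is one of at most
  -- two partners of `v`, at most one is gained.
  · have huv' := memcr.1 huv
    refine ⟨v, huv'.2.1, le_trans (Finset.card_le_card (t := (cr P).erase (u, v) ∪
      ((Finset.univ.filter (r v)).erase u).image (v, ·)) fun p hp => ?_) ?_⟩
    · obtain ⟨h1, h2, h3⟩ := memcr.1 hp
      rw [Finset.mem_insert] at h1
      rw [Finset.mem_insert, not_or] at h2
      rw [Finset.mem_union]
      rcases h1 with h1 | h1
      · right
        refine Finset.mem_image.2 ⟨p.2, Finset.mem_erase.2 ⟨?_, by simpa [h1] using h3⟩,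
          by rw [← h1]⟩
        intro h
        exact h2.2 (h ▸ huv'.1)
      · left
        refine Finset.mem_erase.2 ⟨?_, memcr.2 ⟨h1, h2.2, h3⟩⟩
        rintro rfl
        exact h2.1 rfl
    · refine (Finset.card_union_le _ _).trans ?_
      have h1 := Finset.card_erase_of_mem huv
      have h2 := Finset.card_erase_of_mem (s := Finset.univ.filter (r v)) (a := u)
        (by simpa using hr _ _ huv'.2.2)
      have h3 := Finset.card_image_le (s := (Finset.univ.filter (r v)).erase u) (f := (v, ·))
      have h4 := hdeg v
      omega

/-- Apart from `B` and the at most two inner ends of crossing deviations, the neighbourhood of a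
vertex outside `P` depends only on its layer; the third unit in `B.card + 3` is the tag shared by
these ordinary vertices. -/
theorem Layered.reach [Fintype V] [Fintype ι] (hG : Tame G) (h : Layered G X E b) {B : Finset V}
    {c : V → ι} (hc : ∀ v i, v ∈ X i ↔ c v = i) (hBE : ∀ v ∉ B, ∀ p, v ∉ E p)
    (hB : ∀ v ∉ B, 20 ≤ (X (c v)).card) {k : ℕ} (hk : (B.card + 3) * Fintype.card ι ≤ k) :
    Reach k G Finset.univ := by
  have hdeg := h.card_devs_le hG (fun v => (hc v _).2 rfl) hBE hB
  have hcut : ∀ P, B ⊆ P → (Finset.univ.filter fun p : V × V =>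
      p.1 ∈ P ∧ p.2 ∉ P ∧ Dev G b B c p.1 p.2).card ≤ 2 → Cut k G P := by
    intro P hBP hcr
    have hcard : (B ∪ (Finset.univ.filter fun p : V × V =>
        p.1 ∈ P ∧ p.2 ∉ P ∧ Dev G b B c p.1 p.2).image Prod.fst).card ≤ B.card + 2 :=
      (Finset.card_union_le _ _).trans (Nat.add_le_add_left (Finset.card_image_le.trans hcr) _)
    refine Cut.of_colouring (E := B ∪ (Finset.univ.filter fun p : V × V =>
      p.1 ∈ P ∧ p.2 ∉ P ∧ Dev G b B c p.1 p.2).image Prod.fst) c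
      ((Nat.mul_le_mul_right _ (Nat.succ_le_succ hcard)).trans hk) ?_
    intro x hx y hy hxE hyE hxy w hw
    have hnd : ∀ x ∈ P, x ∉ B ∪ (Finset.univ.filter fun p : V × V =>
        p.1 ∈ P ∧ p.2 ∉ P ∧ Dev G b B c p.1 p.2).image Prod.fst → c x ≠ c w →
        (G.Adj x w ↔ b s(c x, c w)) := by
      intro x hx hxE hxw
      rw [Finset.mem_union, not_or] at hxE
      by_contra hn
      exact hxE.2 (Finset.mem_image.2 ⟨(x, w), by
        simpa using ⟨hx, hw, hxE.1, fun h => hw (hBP h), hxw, hn⟩, rfl⟩)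
    by_cases hxw : c x = c w
    · have hmx := (hc x _).2 hxw
      have hmy := (hc y _).2 (hxy.symm.trans hxw)
      have hmw := (hc w _).2 rfl
      have hx' : x ≠ w := by rintro rfl; exact hw hx
      have hy' : y ≠ w := by rintro rfl; exact hw hy
      rcases h.hom (c w) with hX | hX
      · exact iff_of_true (hX hmx hmw hx') (hX hmy hmw hy')
      · exact iff_of_false (hX hmx hmw hx') (hX hmy hmw hy')
    · rw [hnd x hx hxE hxw, hnd y hy hyE (hxy ▸ hxw), hxy]
  have hreach : ∀ n (P : Finset V), (Pᶜ).card = n → B ⊆ P → (Finset.univ.filter fun p : V × V =>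
      p.1 ∈ P ∧ p.2 ∉ P ∧ Dev G b B c p.1 p.2).card ≤ 2 → Reach k G P →
      Reach k G Finset.univ := by
    intro n
    induction n with
    | zero =>
      intro P hP _ _ hR
      rw [Finset.card_eq_zero, Finset.compl_eq_empty_iff] at hP
      subst hP
      exact hR
    | succ n ih =>
      intro P hn hBP hcr hR
      obtain ⟨v, hv, hcr'⟩ := exists_insert_crossing_le (fun _ _ => Dev.symm) hdeg
        (P := P) (by rintro rfl; simp at hn) hcr
      have hBP' := hBP.trans (Finset.subset_insert v P)
      refine ih (insert v P) ?_ hBP' hcr' (Reach.insert v P hv hR (hcut _ hBP' hcr'))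
      rw [Finset.card_compl, Finset.card_insert_of_notMem hv]
      rw [Finset.card_compl] at hn
      omega
  refine hreach _ B rfl subset_rfl ?_ ?_
  · refine le_trans (Nat.le_of_eq (Finset.card_eq_zero.2 ?_)) zero_le_two
    refine Finset.filter_eq_empty_iff.2 fun p _ hp => hp.2.2.1 hp.1
  · refine Reach.empty.extend (Finset.empty_subset _) fun Z _ hZ => ?_
    exact Cut.of_colouring (E := B) c ((Nat.mul_le_mul_right _ (by omega)).trans hk)
      fun x hx _ _ hxB => absurd (hZ hx) hxB

theorem Coverable.reach [Fintype V] (hG : Tame G) (hU : ¬ HasU G) (hU' : ¬ HasU Gᶜ) {m : ℕ}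
    (h : Coverable m G Finset.univ) :
    Reach ((m * 20 + m * m * 6 + 3) * m) G Finset.univ := by
  obtain ⟨F, hF, hFhom, hFcov⟩ := h
  choose c₀ hc₀ hvc₀ using fun v => hFcov v (Finset.mem_univ v)
  let c : V → F := fun v => ⟨c₀ v, hc₀ v⟩
  let X : F → Finset V := fun i => Finset.univ.filter fun v => c v = i
  have hX : ∀ v i, v ∈ X i ↔ c v = i := by simp [X]
  have hXsub : ∀ i : F, (X i : Set V) ⊆ (i : Finset V) := by
    intro i v hv
    have : c v = i := (hX v i).1 hv
    rw [← this]
    exact hvc₀ v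
  have hhom : ∀ i, G.IsClique (X i : Set V) ∨ G.IsIndepSet (X i : Set V) := fun i =>
    (hFhom i i.2).imp (fun h => h.subset (hXsub i)) fun h => Set.Pairwise.mono (hXsub i) h
  have hdisj : ∀ i j, i ≠ j → Disjoint (X i) (X j) := fun i j hij =>
    Finset.disjoint_left.2 fun v hi hj => hij (((hX v i).1 hi).symm.trans ((hX v j).1 hj))
  -- Chosen per unordered pair, so that both orders of two layers receive the same `E` and `b`.
  have hpair : ∀ p : Sym2 F, ∃ (E : Finset V) (b : Prop), E.card ≤ 6 ∧
      ∀ i j, s(i, j) = p → i ≠ j → 20 ≤ (X i).card → 20 ≤ (X j).card →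
        PairOK G (X i) (X j) E b := by
    intro p
    induction p using Sym2.ind with
    | _ i j =>
    by_cases hij : i ≠ j ∧ 20 ≤ (X i).card ∧ 20 ≤ (X j).card
    · obtain ⟨E, b, hE, h⟩ := exists_pairOK hG (hdisj i j hij.1) (hhom i) (hhom j) hij.2.1 hij.2.2
        (Or.inl hU) (Or.inl hU')
      refine ⟨E, b, hE, fun i' j' h' _ _ _ => ?_⟩
      rcases Sym2.eq_iff.1 h' with ⟨rfl, rfl⟩ | ⟨rfl, rfl⟩
      · exact h
      · exact h.symm
    · refine ⟨∅, True, by simp, fun i' j' h' h1 h2 h3 => absurd ?_ hij⟩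
      rcases Sym2.eq_iff.1 h' with ⟨rfl, rfl⟩ | ⟨rfl, rfl⟩
      · exact ⟨h1, h2, h3⟩
      · exact ⟨h1.symm, h3, h2⟩
  choose E b hE hEb using hpair
  -- All small layers, at most `m * 20` vertices, and all exceptional sets, at most `m * m * 6`.
  let B : Finset V := ((Finset.univ.filter fun i => (X i).card ≤ 20).biUnion X) ∪
    (Finset.univ : Finset (F × F)).biUnion fun p => E s(p.1, p.2)
  have hFc : Fintype.card F ≤ m := by simpa using hF
  have hBcard : B.card ≤ m * 20 + m * m * 6 := by
    refine (Finset.card_union_le _ _).trans (Nat.add_le_add ?_ ?_)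
    · refine (Finset.card_biUnion_le_card_mul _ _ 20 fun i hi => (Finset.mem_filter.1 hi).2).trans ?_
      exact Nat.mul_le_mul_right _ ((Finset.card_filter_le _ _).trans hFc)
    · refine (Finset.card_biUnion_le_card_mul _ _ 6 fun p _ => hE _).trans ?_
      refine Nat.mul_le_mul_right _ ?_
      rw [Finset.card_univ, Fintype.card_prod]
      exact Nat.mul_le_mul hFc hFc
  have hlay : Layered G X E b := ⟨hdisj, hhom, hE, fun i j => hEb _ i j rfl⟩
  refine hlay.reach hG hX (B := B) ?_ ?_
    (Nat.mul_le_mul (Nat.add_le_add_right hBcard 3) hFc)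
  · intro v hv p
    induction p using Sym2.ind with
    | _ i j =>
    intro hvE
    exact hv (Finset.mem_union_right _ (Finset.mem_biUnion.2 ⟨(i, j), Finset.mem_univ _, hvE⟩))
  · intro v hv
    by_contra! hlt
    exact hv (Finset.mem_union_left _ (Finset.mem_biUnion.2
      ⟨c v, Finset.mem_filter.2 ⟨Finset.mem_univ _, hlt.le⟩, (hX v _).2 rfl⟩))

end Layers

/-! ### Complementation and the induced subgraph relation -/

section Complement

open Classical

variable {V : Type u} {k : ℕ} {G : SimpleGraph V}

/-- A vertex outside `P` differs from `x` and `y`, so complementation negates both adjacencies. -/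
theorem Cut.of_compl {P : Finset V} (h : Cut k Gᶜ P) : Cut k G P := by
  obtain ⟨c, hc⟩ := h
  refine ⟨c, fun x hx y hy hxy w hw => ?_⟩
  have h1 := hc x hx y hy hxy w hw
  have hx' : x ≠ w := by rintro rfl; exact hw hx
  have hy' : y ≠ w := by rintro rfl; exact hw hy
  simp only [SimpleGraph.compl_adj] at h1
  tauto

theorem Reach.of_compl {P : Finset V} (h : Reach k Gᶜ P) : Reach k G P := by
  induction h with
  | empty => exact Reach.empty
  | insert v P hv _ hc ih => exact Reach.insert v P hv ih hc.of_compl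

theorem hfree_of_not_isIndContained (h : ¬ (twoP1AddP3 ⊴ G)) : HFree G := by
  intro a b x y z hab hab' hxz hxz' hxy hyz hax hay haz hbx hby hbz
  let f : (Fin 1 ⊕ Fin 1) ⊕ Fin 3 → V := Sum.elim (Sum.elim (fun _ => a) fun _ => b) ![x, y, z]
  -- `HFree` assumes only `a ≠ b` and `x ≠ z`; the other inequalities follow from the adjacencies.
  have hinj : Function.Injective f := by
    have e1 := hxy.ne
    have e2 := hyz.ne
    have e3 : a ≠ x := by rintro rfl; exact hay hxy
    have e4 : a ≠ y := by rintro rfl; exact hax hxy.symm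
    have e5 : a ≠ z := by rintro rfl; exact hay hyz.symm
    have e6 : b ≠ x := by rintro rfl; exact hby hxy
    have e7 : b ≠ y := by rintro rfl; exact hbx hxy.symm
    have e8 : b ≠ z := by rintro rfl; exact hby hyz.symm
    rintro ((i | i) | i) ((j | j) | j) <;> fin_cases i <;> fin_cases j <;>
      simp [f, hab, hxz, e1, e2, e3, e4, e5, e6, e7, e8, hab.symm, hxz.symm, e1.symm, e2.symm,
        e3.symm, e4.symm, e5.symm, e6.symm, e7.symm, e8.symm]
  have hadj : ∀ p q, G.Adj (f p) (f q) ↔ twoP1AddP3.Adj p q := by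
    have ha := G.adj_comm a
    have hb := G.adj_comm b
    have hz := G.adj_comm z
    have hy := G.adj_comm y x
    rintro ((i | i) | i) ((j | j) | j) <;> fin_cases i <;> fin_cases j <;>
      simp [f, twoP1AddP3, pathGraph_adj, hab', hxz', hxy, hyz, hax, hay, haz, hbx, hby, hbz,
        ← ha, ← hb, hz, hy]
  exact h ⟨⟨⟨f, hinj⟩, fun {p q} => hadj p q⟩⟩

end Complement

end CliqueWidthBound

open CliqueWidthBound in
theorem mainTheorem1 :
    ∃ c : ℕ, ∀ (V : Type u) [Finite V] (G : SimpleGraph V),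
      ¬ (twoP1AddP3 ⊴ G) → ¬ (twoP1AddP3ᶜ ⊴ G) → cliqueWidth G ≤ (c : ℕ∞) := by
  -- The sum of the bounds of the two cases: `84` with one extra label, and `Coverable.reach` for `m
  -- = 1040` with one extra label.
  refine ⟨84 + 1 + ((1040 * 20 + 1040 * 1040 * 6 + 3) * 1040 + 1), fun V _ G h h' => ?_⟩
  have := Fintype.ofFinite V
  have hG : Tame G := ⟨hfree_of_not_isIndContained h, hfree_of_not_isIndContained fun ⟨f⟩ =>
    h' ⟨by simpa using (SimpleGraph.Embedding.complEquiv f)⟩⟩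
  by_cases hU : HasU G
  · exact (reach_of_hasU hG hU).cliqueWidth_le.trans (Nat.cast_le.2 (Nat.le_add_right _ _))
  by_cases hU' : HasU Gᶜ
  · exact (reach_of_hasU hG.compl hU').of_compl.cliqueWidth_le.trans
      (Nat.cast_le.2 (Nat.le_add_right _ _))
  · exact ((hG.coverable hU hU' Finset.univ).reach hG hU hU').cliqueWidth_le.trans
      (Nat.cast_le.2 (Nat.le_add_left _ _))
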